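/- Fix finite sets $\Gamma_1$ (vertex labels) and $\Gamma_2$ (edge labels). **Slices.** A unit slice of arity $r\ge 0$ is a finite directed multigraph $S$ with source and target maps, whose vertex set is the disjoint union of a center $C$ that is empty or the single vertex $1$, an out-frontier $F_0$, and in-frontiers $F_1,\dots,F_r$; the elements of $F_j$ are of the form $[j,i]$ with $i\ge 1$ an integer. The center vertex, if any, has a label in $\Gamma_1$ and each edge has a label in $\Gamma_2$. No edge has both endpoints in the same frontier, and every frontier vertex is an endpoint of exactly one edge. (The edges are taken to be numbered $0,\dots,m-1$; edges from the center to itself are allowed.) $S$ is normalized if $F_j=\{[j,1],\dots,[j,|F_j|]\}$ for all $j$, and its width is $\max_j |F_j|$. For $c\in\mathbb N$, $\Sigma(c,\Gamma_1,\Gamma_2)$ is the set of all normalized unit slices of arity at most $2$ and width at most $c$, where a slice of arity $r$ is a function symbol of arity $r$. **Unit decompositions.** $S$ can be glued to $S'$ at frontier $j$ if $[0,i]\in F_0(S)\iff[j,i]\in F_j(S')$ for all $i$, and for each such $i$ the edge of $S$ at $[0,i]$ and the edge of $S'$ at $[j,i]$ have the same label, and either the former has target $[0,i]$ and the latter has source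 $[j,i]$, or the former has source $[0,i]$ and the latter has target $[j,i]$. A unit decomposition over a set $\Sigma$ of unit slices is a ground term $\mathbf T$ over $\Sigma$ such that for any positions $p,pj$ of $\mathbf T$ the slice $\mathbf T[pj]$ can be glued to $\mathbf T[p]$ at frontier $j$, and such that the root slice has empty out-frontier; $\mathcal L(\Sigma)$ is the set of all of them. $\mathbf T$ is normalized if all its slices are. **The represented digraph.** $\overset{\circ}{\mathbf T}$ has one vertex $v_p$ for each position $p$ at which $\mathbf T[p]$ has a nonempty center, with the label of that center, and one edge for each sliced edge sequence, that is, each nonempty sequence $(p_1,e_1)\cdots(p_n,e_n)$, $e_i$ an edge of $\mathbf T[p_i]$ with source $a_i$ and target $b_i$, such that $a_1$ and $b_n$ are center vertices and for each $i<n$ there are $j,k$ with either $p_i=p_{i+1}j$, $b_i=[0,k]$, $a_{i+1}=[j,k]$, or $p_{i+1}=p_ij$, $b_i=[j,k]$, $a_{i+1}=[0,k]$. This edge goes from $v_{p_1}$ to $v_{p_n}$ and has the common label of the $e_i$. **Logic.** $\mathrm{MSO}_2$ formulas over $(\Gamma_1,\Gamma_2)$-labeled digraphs are built with $\vee,\wedge,\neg,\exists$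 from variables for vertices, edges, sets of vertices and sets of edges, with the atomic formulas: membership, equality (for each of the four sorts), "$x$ is the source of $y$", "$x$ is the target of $y$", "$x$ has label $a$" ($a\in\Gamma_1$), "$y$ has label $b$" ($b\in\Gamma_2$). A sentence is a formula without free variables. **Automata.** A tree-automaton over $\Sigma$ has a finite set $Q$ of states, a set $Q_F\subseteq Q$ of final states and transitions $(q_1,\dots,q_r,S,q)$ with $S\in\Sigma$ of arity $r$; a term $S(t_1,\dots,t_r)$ reaches $q$ if there is a transition $(q_1,\dots,q_r,S,q)$ such that each $t_i$ reaches $q_i$, and $\mathcal L(\mathcal A)$ is the set of terms that reach a final state. It is deterministic if for all $q_1,\dots,q_r,S$ there is at most one such $q$; it is a slice tree-automaton if $\mathcal L(\mathcal A)\subseteq\mathcal L(\Sigma)$, and normalized if all terms of $\mathcal L(\mathcal A)$ are normalized. **Lemma.** For every $\mathrm{MSO}_2$ sentence $\varphi$ over $(\Gamma_1,\Gamma_2)$-labeled digraphs and every $c\in\mathbb N$ one can construct a normalized deterministic slice tree-automaton $\mathcal A(\varphi,c)$ over $\Sigma(c,\Gamma_1,\Gamma_2)$ such that $$\mathcal L(\mathcal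 A(\varphi,c))=\{\mathbf T\in\mathcal L(\Sigma(c,\Gamma_1,\Gamma_2)) \mid \overset{\circ}{\mathbf T}\models\varphi\}.$$ Here "one can construct" means: the number of states of $\mathcal A(\varphi,c)$ is a computable function of $(\varphi,c)$, and there are algorithms that, given $\varphi$, $c$ and a state, respectively a tuple $(q_1,\dots,q_r,S,q)$, decide whether the state is final, respectively whether the tuple is a transition. (As the number of edges from the center to itself is not bounded, $\Sigma(c,\Gamma_1,\Gamma_2)$ may be infinite; on each finite subset of it, for instance on the slices without such edges, the transitions form a finite table that can be computed.) -/

import Mathlib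

namespace SliceTree

universe u v w

/-! ### Ranked terms and bottom-up tree automata -/

/-- Ground terms over a ranked alphabet `F`, the symbol `f` having arity `ar f`. -/
inductive Term {F : Type u} (ar : F → ℕ) : Type u
  | node (f : F) (ts : Fin (ar f) → Term ar) : Term ar

namespace Term

variable {F : Type u} {ar : F → ℕ}

/-- The leading symbol of a term. -/
def leading : Term ar → F
  | node f _ => f

/-- The subterm at a string of child indices (the children of `f` are numbered `1, …, ar f`);
`none` if the string is not a position. -/
def subterm? : Term ar → List ℕ → Option (Term ar)
  | t, [] => some t
  | node f ts, j :: p =>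
      if h : 1 ≤ j ∧ j ≤ ar f then subterm? (ts ⟨j - 1, by omega⟩) p else none

/-- The positions of a term. -/
def Pos (t : Term ar) : Type := {p : List ℕ // (t.subterm? p).isSome}

/-- `t[p]`, the symbol of `t` at the position `p`. -/
def symbolAt (t : Term ar) (p : t.Pos) : F := ((t.subterm? p.1).get p.2).leading

end Term

/-- A (bottom-up, in general nondeterministic) tree automaton over the ranked alphabet `(F, ar)`.
Its finite set of states is `{0, …, numStates - 1}`; `trans f qs q` says that
`(qs, f, q)` is a transition. -/
structure TreeAutomaton {F : Type u} (ar : F → ℕ) where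
  numStates : ℕ
  final : Set (Fin numStates)
  trans : (f : F) → (Fin (ar f) → Fin numStates) → Fin numStates → Prop

namespace TreeAutomaton

variable {F : Type u} {ar : F → ℕ}

/-- The term `t` reaches the state `q`. -/
inductive Reaches (A : TreeAutomaton ar) : Term ar → Fin A.numStates → Prop
  | node (f : F) (ts : Fin (ar f) → Term ar) (qs : Fin (ar f) → Fin A.numStates)
      (q : Fin A.numStates) (hts : ∀ i, Reaches A (ts i) (qs i)) (hq : A.trans f qs q) :
      Reaches A (Term.node f ts) q

/-- The tree language generated by `A`. -/
def language (A : TreeAutomaton ar) : Set (Term ar) := {t | ∃ q ∈ A.final, A.Reaches t q}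

def IsDeterministic (A : TreeAutomaton ar) : Prop :=
  ∀ (f : F) (qs : Fin (ar f) → Fin A.numStates) (q q' : Fin A.numStates),
    A.trans f qs q → A.trans f qs q' → q = q'

end TreeAutomaton

/-! ### Unit slices -/

/-- Possible vertices of a unit slice: the center vertex, and the frontier vertices `[j, i]`. -/
inductive SliceVertex : Type
  | center : SliceVertex
  | frontier (j i : ℕ) : SliceVertex
  deriving DecidableEq

/-- Membership in the vertex set of a slice with the given center and frontiers. -/
def SliceVertex.MemVertices {Γ₁ : Type u} (center : Option Γ₁) (frontier : ℕ → Finset ℕ) :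
    SliceVertex → Prop
  | .center => center.isSome
  | .frontier j i => i ∈ frontier j

/-- A unit slice of arity `arity`, with vertex labels in `Γ₁` and edge labels in `Γ₂`.

`center` is `none` if the center is empty and `some a` if the center is a single vertex labeled `a`.
`frontier j` is the set of numbers `i` such that `[j, i]` is a vertex of the `j`-th frontier;
`j = 0` is the out-frontier and `j = 1, …, arity` are the in-frontiers.
The edges are numbered `0, …, numEdges - 1`; edges from the center to itself are allowed,
in any number. -/
structure UnitSlice (Γ₁ : Type u) (Γ₂ : Type v) where
  arity : ℕ
  center : Option Γ₁
  frontier : ℕ → Finset ℕ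
  numEdges : ℕ
  source : Fin numEdges → SliceVertex
  target : Fin numEdges → SliceVertex
  edgeLabel : Fin numEdges → Γ₂
  frontier_pos : ∀ j, ∀ i ∈ frontier j, 1 ≤ i
  frontier_eq_empty : ∀ j, arity < j → frontier j = ∅
  source_mem : ∀ e, (source e).MemVertices center frontier
  target_mem : ∀ e, (target e).MemVertices center frontier
  /-- No edge has both endpoints in the same frontier. -/
  not_same_frontier : ∀ e j i i', ¬ (source e = .frontier j i ∧ target e = .frontier j i')
  /-- Each frontier vertex is an endpoint of exactly one edge. -/
  existsUnique_edge : ∀ j, ∀ i ∈ frontier j,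
    ∃! e, source e = .frontier j i ∨ target e = .frontier j i

namespace UnitSlice

variable {Γ₁ : Type u} {Γ₂ : Type v}

/-- All frontiers have the form `{[j, 1], …, [j, c_j]}`. -/
def IsNormalized (S : UnitSlice Γ₁ Γ₂) : Prop :=
  ∀ j ≤ S.arity, S.frontier j = Finset.Icc 1 (S.frontier j).card

/-- The size of the largest frontier. -/
def width (S : UnitSlice Γ₁ Γ₂) : ℕ :=
  (Finset.range (S.arity + 1)).sup fun j => (S.frontier j).card

/-- The greatest number occurring in a frontier. -/
def extraWidth (S : UnitSlice Γ₁ Γ₂) : ℕ :=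
  (Finset.range (S.arity + 1)).sup fun j => (S.frontier j).sup id

/-- `S` can be glued to `S'` at the in-frontier `j` of `S'`. The two edges `e` and `e'` below are
the unique edges incident with `[0, i]` and `[j, i]`. -/
def CanGlue (S S' : UnitSlice Γ₁ Γ₂) (j : ℕ) : Prop :=
  (∀ i, i ∈ S.frontier 0 ↔ i ∈ S'.frontier j) ∧
  ∀ i ∈ S.frontier 0, ∀ (e : Fin S.numEdges) (e' : Fin S'.numEdges),
    (S.source e = .frontier 0 i ∨ S.target e = .frontier 0 i) →
    (S'.source e' = .frontier j i ∨ S'.target e' = .frontier j i) →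
      S.edgeLabel e = S'.edgeLabel e' ∧
      ((S.target e = .frontier 0 i ∧ S'.source e' = .frontier j i) ∨
       (S.source e = .frontier 0 i ∧ S'.target e' = .frontier j i))

end UnitSlice

/-- `Σ(c, q, Γ₁, Γ₂)`: unit slices of arity at most `2`, width at most `c` and extra-width
at most `q`. -/
def sliceAlphabet (c q : ℕ) (Γ₁ : Type u) (Γ₂ : Type v) : Set (UnitSlice Γ₁ Γ₂) :=
  {S | S.arity ≤ 2 ∧ S.width ≤ c ∧ S.extraWidth ≤ q}

/-- `Σ(c, Γ₁, Γ₂)`: the normalized slices in `Σ(c, c, Γ₁, Γ₂)`. -/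
def normalizedAlphabet (c : ℕ) (Γ₁ : Type u) (Γ₂ : Type v) : Set (UnitSlice Γ₁ Γ₂) :=
  {S | S ∈ sliceAlphabet c c Γ₁ Γ₂ ∧ S.IsNormalized}

/-! ### Unit decompositions and the digraphs they represent -/

/-- The arity of a symbol of a slice alphabet. -/
def sliceArity {Γ₁ : Type u} {Γ₂ : Type v} {Sig : Set (UnitSlice Γ₁ Γ₂)} (S : Sig) : ℕ :=
  S.1.arity

/-- Terms over a slice alphabet. -/
abbrev SliceTerm {Γ₁ : Type u} {Γ₂ : Type v} (Sig : Set (UnitSlice Γ₁ Γ₂)) : Type (max u v) :=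
  Term (sliceArity (Sig := Sig))

/-- Vertex- and edge-labeled directed multigraphs. -/
structure LabeledDigraph (Γ₁ : Type u) (Γ₂ : Type v) where
  V : Type
  E : Type
  src : E → V
  tgt : E → V
  vertexLabel : V → Γ₁
  edgeLabel : E → Γ₂

namespace SliceTerm

variable {Γ₁ : Type u} {Γ₂ : Type v} {Sig : Set (UnitSlice Γ₁ Γ₂)}

/-- The slice `T[p]`. -/
def slice (T : SliceTerm Sig) (p : T.Pos) : UnitSlice Γ₁ Γ₂ := (T.symbolAt p).1

/-- Slices at consecutive positions `p`, `pj` can be glued at frontier `j`. -/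
def IsUnitPreDecomposition (T : SliceTerm Sig) : Prop :=
  ∀ (p p' : T.Pos) (j : ℕ), p'.1 = p.1 ++ [j] → (slice T p').CanGlue (slice T p) j

/-- A unit pre-decomposition whose root slice has an empty out-frontier. -/
def IsUnitDecomposition (T : SliceTerm Sig) : Prop :=
  IsUnitPreDecomposition T ∧ T.leading.1.frontier 0 = ∅

/-- All slices of the term are normalized. -/
def IsNormalized (T : SliceTerm Sig) : Prop := ∀ p : T.Pos, (slice T p).IsNormalized

/-- An edge of the slice at some position of `T`. -/
structure EdgePart (T : SliceTerm Sig) where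
  pos : T.Pos
  edge : Fin (slice T pos).numEdges

namespace EdgePart

variable {T : SliceTerm Sig}

def source (x : EdgePart T) : SliceVertex := (slice T x.pos).source x.edge

def target (x : EdgePart T) : SliceVertex := (slice T x.pos).target x.edge

def label (x : EdgePart T) : Γ₂ := (slice T x.pos).edgeLabel x.edge

/-- `y` continues `x` in a neighbouring slice: either `x` leaves its slice through the out-frontier
and enters the slice at the parent position, or it leaves through the `j`-th in-frontier and enters
the slice at the `j`-th child. -/
def Continues (x y : EdgePart T) : Prop :=
  ∃ j k : ℕ,
    (x.pos.1 = y.pos.1 ++ [j] ∧ x.target = .frontier 0 k ∧ y.source = .frontier j k) ∨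
    (y.pos.1 = x.pos.1 ++ [j] ∧ x.target = .frontier j k ∧ y.source = .frontier 0 k)

end EdgePart

/-- Sliced edge sequences: sequences of consecutive edge parts leading from a center vertex to a
center vertex. -/
structure SlicedEdgeSequence (T : SliceTerm Sig) where
  parts : List (EdgePart T)
  ne_nil : parts ≠ []
  chain : parts.IsChain EdgePart.Continues
  source_eq : (parts.head ne_nil).source = .center
  target_eq : (parts.getLast ne_nil).target = .center

/-- The positions whose slice has a nonempty center. -/
def Support (T : SliceTerm Sig) : Type := {p : T.Pos // (slice T p).center.isSome}

/-- The digraph represented by `T`: one vertex for each position of the support, one edge for each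
sliced edge sequence, with the labels of the center vertices and of the sliced parts (the first one,
but all of them agree in a unit decomposition). -/
def toDigraph (T : SliceTerm Sig) : LabeledDigraph Γ₁ Γ₂ where
  V := Support T
  E := SlicedEdgeSequence T
  src K := ⟨(K.parts.head K.ne_nil).pos, by
    have h := (slice T (K.parts.head K.ne_nil).pos).source_mem (K.parts.head K.ne_nil).edge
    have h' := K.source_eq
    unfold EdgePart.source at h'
    rw [h'] at h
    exact h⟩
  tgt K := ⟨(K.parts.getLast K.ne_nil).pos, by
    have h := (slice T (K.parts.getLast K.ne_nil).pos).target_mem (K.parts.getLast K.ne_nil).edge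
    have h' := K.target_eq
    unfold EdgePart.target at h'
    rw [h'] at h
    exact h⟩
  vertexLabel p := (slice T p.1).center.get p.2
  edgeLabel K := (K.parts.head K.ne_nil).label

end SliceTerm

/-- `L(Σ)`: all unit decompositions over the slice alphabet `Σ`. -/
def unitDecompositions {Γ₁ : Type u} {Γ₂ : Type v} (Sig : Set (UnitSlice Γ₁ Γ₂)) :
    Set (SliceTerm Sig) :=
  {T | SliceTerm.IsUnitDecomposition T}

/-- Tree automata over a slice alphabet. -/
abbrev SliceAutomaton {Γ₁ : Type u} {Γ₂ : Type v} (Sig : Set (UnitSlice Γ₁ Γ₂)) :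
    Type (max u v) :=
  TreeAutomaton (sliceArity (Sig := Sig))

/-- A slice tree-automaton accepts unit decompositions only. -/
def IsSliceTreeAutomaton {Γ₁ : Type u} {Γ₂ : Type v} {Sig : Set (UnitSlice Γ₁ Γ₂)}
    (A : SliceAutomaton Sig) : Prop :=
  A.language ⊆ unitDecompositions Sig

/-- All accepted terms are normalized. -/
def IsNormalizedAutomaton {Γ₁ : Type u} {Γ₂ : Type v} {Sig : Set (UnitSlice Γ₁ Γ₂)}
    (A : SliceAutomaton Sig) : Prop :=
  ∀ T ∈ A.language, SliceTerm.IsNormalized T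

/-! ### The logic MSO₂ of labeled digraphs -/

/-- Variables of the four sorts, each sort having the names `0, 1, 2, …`. -/
inductive MSOVar : Type
  | vertex (x : ℕ) : MSOVar
  | edge (y : ℕ) : MSOVar
  | vertexSet (X : ℕ) : MSOVar
  | edgeSet (Y : ℕ) : MSOVar
  deriving DecidableEq

/-- `MSO₂` formulas over `(Γ₁, Γ₂)`-labeled digraphs. -/
inductive MSO2 (Γ₁ : Type u) (Γ₂ : Type v) : Type (max u v)
  | memV (x X : ℕ) : MSO2 Γ₁ Γ₂
  | memE (y Y : ℕ) : MSO2 Γ₁ Γ₂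
  | eqV (x x' : ℕ) : MSO2 Γ₁ Γ₂
  | eqE (y y' : ℕ) : MSO2 Γ₁ Γ₂
  | eqVSet (X X' : ℕ) : MSO2 Γ₁ Γ₂
  | eqESet (Y Y' : ℕ) : MSO2 Γ₁ Γ₂
  | isSource (y x : ℕ) : MSO2 Γ₁ Γ₂
  | isTarget (y x : ℕ) : MSO2 Γ₁ Γ₂
  | hasVertexLabel (x : ℕ) (a : Γ₁) : MSO2 Γ₁ Γ₂
  | hasEdgeLabel (y : ℕ) (b : Γ₂) : MSO2 Γ₁ Γ₂
  | or (φ ψ : MSO2 Γ₁ Γ₂) : MSO2 Γ₁ Γ₂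
  | and (φ ψ : MSO2 Γ₁ Γ₂) : MSO2 Γ₁ Γ₂
  | not (φ : MSO2 Γ₁ Γ₂) : MSO2 Γ₁ Γ₂
  | exV (x : ℕ) (φ : MSO2 Γ₁ Γ₂) : MSO2 Γ₁ Γ₂
  | exE (y : ℕ) (φ : MSO2 Γ₁ Γ₂) : MSO2 Γ₁ Γ₂
  | exVSet (X : ℕ) (φ : MSO2 Γ₁ Γ₂) : MSO2 Γ₁ Γ₂
  | exESet (Y : ℕ) (φ : MSO2 Γ₁ Γ₂) : MSO2 Γ₁ Γ₂

/-- An interpretation of variables in `G`. The domain may be empty, so vertex and edge variables may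
stay uninterpreted; the value at variables that are not free in a formula is irrelevant. -/
structure Interpretation {Γ₁ : Type u} {Γ₂ : Type v} (G : LabeledDigraph Γ₁ Γ₂) where
  vertex : ℕ → Option G.V
  edge : ℕ → Option G.E
  vertexSet : ℕ → Set G.V
  edgeSet : ℕ → Set G.E

namespace MSO2

variable {Γ₁ : Type u} {Γ₂ : Type v}

/-- The free variables of a formula. -/
def freeVars : MSO2 Γ₁ Γ₂ → Set MSOVar
  | memV x X => {.vertex x, .vertexSet X}
  | memE y Y => {.edge y, .edgeSet Y}
  | eqV x x' => {.vertex x, .vertex x'}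
  | eqE y y' => {.edge y, .edge y'}
  | eqVSet X X' => {.vertexSet X, .vertexSet X'}
  | eqESet Y Y' => {.edgeSet Y, .edgeSet Y'}
  | isSource y x => {.edge y, .vertex x}
  | isTarget y x => {.edge y, .vertex x}
  | hasVertexLabel x _ => {.vertex x}
  | hasEdgeLabel y _ => {.edge y}
  | or φ ψ => freeVars φ ∪ freeVars ψ
  | and φ ψ => freeVars φ ∪ freeVars ψ
  | not φ => freeVars φ
  | exV x φ => freeVars φ \ {.vertex x}
  | exE y φ => freeVars φ \ {.edge y}
  | exVSet X φ => freeVars φ \ {.vertexSet X}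
  | exESet Y φ => freeVars φ \ {.edgeSet Y}

def IsSentence (φ : MSO2 Γ₁ Γ₂) : Prop := freeVars φ = ∅

/-- Truth of a formula in `G` under the interpretation `M`. -/
def Holds (G : LabeledDigraph Γ₁ Γ₂) : MSO2 Γ₁ Γ₂ → Interpretation G → Prop
  | memV x X, M => ∃ v, M.vertex x = some v ∧ v ∈ M.vertexSet X
  | memE y Y, M => ∃ e, M.edge y = some e ∧ e ∈ M.edgeSet Y
  | eqV x x', M => ∃ v, M.vertex x = some v ∧ M.vertex x' = some v
  | eqE y y', M => ∃ e, M.edge y = some e ∧ M.edge y' = some e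
  | eqVSet X X', M => M.vertexSet X = M.vertexSet X'
  | eqESet Y Y', M => M.edgeSet Y = M.edgeSet Y'
  | isSource y x, M => ∃ e, M.edge y = some e ∧ M.vertex x = some (G.src e)
  | isTarget y x, M => ∃ e, M.edge y = some e ∧ M.vertex x = some (G.tgt e)
  | hasVertexLabel x a, M => ∃ v, M.vertex x = some v ∧ G.vertexLabel v = a
  | hasEdgeLabel y b, M => ∃ e, M.edge y = some e ∧ G.edgeLabel e = b
  | or φ ψ, M => Holds G φ M ∨ Holds G ψ M
  | and φ ψ, M => Holds G φ M ∧ Holds G ψ M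
  | not φ, M => ¬ Holds G φ M
  | exV x φ, M => ∃ v : G.V, Holds G φ { M with vertex := Function.update M.vertex x (some v) }
  | exE y φ, M => ∃ e : G.E, Holds G φ { M with edge := Function.update M.edge y (some e) }
  | exVSet X φ, M =>
      ∃ W : Set G.V, Holds G φ { M with vertexSet := Function.update M.vertexSet X W }
  | exESet Y φ, M =>
      ∃ W : Set G.E, Holds G φ { M with edgeSet := Function.update M.edgeSet Y W }

/-- A Gödel numbering of formulas. -/
def code [Encodable Γ₁] [Encodable Γ₂] : MSO2 Γ₁ Γ₂ → ℕ
  | memV x X => Nat.pair 0 (Nat.pair x X)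
  | memE y Y => Nat.pair 1 (Nat.pair y Y)
  | eqV x x' => Nat.pair 2 (Nat.pair x x')
  | eqE y y' => Nat.pair 3 (Nat.pair y y')
  | eqVSet X X' => Nat.pair 4 (Nat.pair X X')
  | eqESet Y Y' => Nat.pair 5 (Nat.pair Y Y')
  | isSource y x => Nat.pair 6 (Nat.pair y x)
  | isTarget y x => Nat.pair 7 (Nat.pair y x)
  | hasVertexLabel x a => Nat.pair 8 (Nat.pair x (Encodable.encode a))
  | hasEdgeLabel y b => Nat.pair 9 (Nat.pair y (Encodable.encode b))
  | or φ ψ => Nat.pair 10 (Nat.pair (code φ) (code ψ))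
  | and φ ψ => Nat.pair 11 (Nat.pair (code φ) (code ψ))
  | not φ => Nat.pair 12 (code φ)
  | exV x φ => Nat.pair 13 (Nat.pair x (code φ))
  | exE y φ => Nat.pair 14 (Nat.pair y (code φ))
  | exVSet X φ => Nat.pair 15 (Nat.pair X (code φ))
  | exESet Y φ => Nat.pair 16 (Nat.pair Y (code φ))

end MSO2

/-- `G ⊨ φ`, for sentences `φ`. -/
def LabeledDigraph.Models {Γ₁ : Type u} {Γ₂ : Type v} (G : LabeledDigraph Γ₁ Γ₂)
    (φ : MSO2 Γ₁ Γ₂) : Prop :=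
  φ.Holds G ⟨fun _ => none, fun _ => none, fun _ => ∅, fun _ => ∅⟩

/-- The sentences of `MSO₂`. -/
abbrev Sentence (Γ₁ : Type u) (Γ₂ : Type v) : Type (max u v) :=
  {φ : MSO2 Γ₁ Γ₂ // φ.IsSentence}

/-! ### Effective constructions -/

/-- A vertex of a slice as finite data. -/
def SliceVertex.code : SliceVertex → Option (ℕ × ℕ)
  | .center => none
  | .frontier j i => some (j, i)

/-- A unit slice as finite data: arity, center, the list of the frontiers `0, …, arity`, and the list
of edges with source, target and label. -/
def UnitSlice.code {Γ₁ : Type u} {Γ₂ : Type v} (S : UnitSlice Γ₁ Γ₂) :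
    ℕ × Option Γ₁ × List (List ℕ) × List (Option (ℕ × ℕ) × Option (ℕ × ℕ) × Γ₂) :=
  (S.arity, S.center,
    (List.range (S.arity + 1)).map fun j => (S.frontier j).sort (· ≤ ·),
    List.ofFn fun e => ((S.source e).code, (S.target e).code, S.edgeLabel e))

/-- The automata `A φ c` over `Σ(c, Γ₁, Γ₂)` can be constructed from `φ` and `c`: there are algorithms
which, given the sentence `φ` and the number `c`, compute the number of states of `A φ c` and decide
which states are final and which tuples `(q₁, …, q_r, S, q)` are transitions. -/
def IsEffectiveFamily {Γ₁ : Type u} {Γ₂ : Type v} [Primcodable Γ₁] [Primcodable Γ₂]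
    (A : Sentence Γ₁ Γ₂ → (c : ℕ) → SliceAutomaton (normalizedAlphabet c Γ₁ Γ₂)) : Prop :=
  ∃ (numStates : ℕ × ℕ → ℕ) (final : (ℕ × ℕ) × ℕ → Bool)
    (trans : (ℕ × ℕ) ×
      (ℕ × Option Γ₁ × List (List ℕ) × List (Option (ℕ × ℕ) × Option (ℕ × ℕ) × Γ₂)) ×
      List ℕ × ℕ → Bool),
    Computable numStates ∧ Computable final ∧ Computable trans ∧
    ∀ (φ : Sentence Γ₁ Γ₂) (c : ℕ),
      (A φ c).numStates = numStates (φ.1.code, c) ∧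
      (∀ q : Fin (A φ c).numStates, q ∈ (A φ c).final ↔ final ((φ.1.code, c), (q : ℕ)) = true) ∧
      (∀ (S : normalizedAlphabet c Γ₁ Γ₂) (qs : Fin (sliceArity S) → Fin (A φ c).numStates)
          (q : Fin (A φ c).numStates),
        (A φ c).trans S qs q ↔
          trans ((φ.1.code, c), S.1.code, List.ofFn (fun i => (qs i : ℕ)), (q : ℕ)) = true)

end SliceTree

open SliceTree

namespace SliceTree

universe u v

/-! The proof is the classical translation of monadic second-order logic into deterministic tree
automata, carried out on slices decorated with bit masks. A vertex of the represented digraph is a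
position with a center; it is marked by bit 0 of the mask at that position. An edge is a sliced
sequence, hence a set of edge parts; bit `e` of the mask at a position marks the part numbered `e`
there.

In a unit decomposition every part lies in exactly one sliced sequence (`exists_sequence`,
`eq_of_mem_parts`): a part has at most one successor and one predecessor, it has them unless it
meets a center, because the out-frontier of the root is empty, and the rank of `exists_rank`
excludes cycles. So sets of edges are the same as sets of parts closed under continuation, and
single edges are the closed sets with exactly one part starting in a center. Closedness is a local
property: the marked edges must show the same records (number, direction, label) on both sides of
each glued frontier (`agree_iff_isClosedSet`). With all edges marked, the same comparison tests
gluing itself (`canGlue_iff_tile`).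

The automaton of a formula is defined by recursion on its code, whose first component is a tag. Tags
0 to 9 are atoms: the automaton searches for a position satisfying a local condition. Tags 10 and 11
(disjunction, conjunction) use products, tag 12 (negation) exchanges final and nonfinal states, and
tags 13 to 16 (quantifiers) use the subset construction over all guesses of a mask, with a guard
automaton checking that the guesses mark a legitimate value (`testBit_run`,
`isFinal_stepRun_quantifier`). The induction on formulas is `isFinal_iff_holds`. A last product adds
the test of gluing.

States are natural numbers, with pairs coded by `Nat.pair` and sets by masks. There are finitely
many because an interface is bounded in terms of `c` and the edge labels, however many loops the
center has (`tile_code_lt`). Transitions, final states and bounds are primitive recursive by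
course-of-values recursion on the code. -/

/-! ### Finite sets of natural numbers as bit masks -/

/-- The number whose binary digits mark the members of `l`. -/
def maskOf (l : List ℕ) : ℕ :=
  l.foldr (fun q acc => bif acc.testBit q then acc else acc + 2 ^ q) 0

theorem testBit_add_two_pow {n q : ℕ} (h : n.testBit q = false) (i : ℕ) :
    (n + 2 ^ q).testBit i = (n.testBit i || decide (i = q)) := by
  rw [add_comm]
  rcases lt_trichotomy i q with hi | rfl | hi
  · rw [Nat.testBit_two_pow_add_gt hi]; simp [hi.ne]
  · rw [Nat.testBit_two_pow_add_eq]; simp [h]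
  · obtain ⟨j, rfl⟩ := Nat.exists_eq_add_of_lt hi
    -- Digit `q` of `n` is 0, so adding 1 to `n / 2 ^ q` turns an even number into the next odd one
    -- and nothing is carried to higher digits.
    have h2 : n / 2 ^ q % 2 = 0 := by
      rw [Nat.testBit_eq_decide_div_mod_eq] at h
      simpa using h
    have h3 : (2 ^ q + n) / 2 ^ q / 2 = n / 2 ^ q / 2 := by
      rw [Nat.add_div_left _ (by positivity)]
      omega
    have e : q + j + 1 = j + 1 + q := by ring
    rw [e, Nat.testBit_add, Nat.testBit_add_one, h3, Nat.testBit_add _ (j + 1), Nat.testBit_add_one]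
    simp

theorem testBit_maskOf (l : List ℕ) (i : ℕ) : (maskOf l).testBit i = decide (i ∈ l) := by
  induction l with
  | nil => simp [maskOf]
  | cons q l ih =>
    change (bif (maskOf l).testBit q then maskOf l else maskOf l + 2 ^ q).testBit i = _
    cases h : (maskOf l).testBit q
    · rw [cond_false, testBit_add_two_pow h, ih]
      by_cases hi : i = q <;> simp [hi]
    · rw [cond_true, ih]
      by_cases hi : i = q
      · subst hi; rw [← ih, h]; simp
      · simp [hi]

theorem maskOf_lt {l : List ℕ} {K : ℕ} (h : ∀ i ∈ l, i < K) : maskOf l < 2 ^ K := by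
  apply Nat.lt_pow_two_of_testBit
  intro i hi
  rw [testBit_maskOf]
  simpa using fun h' => absurd (h i h') (by omega)

theorem maskOf_eq_maskOf {l l' : List ℕ} : maskOf l = maskOf l' ↔ ∀ i, i ∈ l ↔ i ∈ l' := by
  constructor
  · intro h i
    have := congrArg (fun n => n.testBit i) h
    simpa [testBit_maskOf] using this
  · intro h
    apply Nat.eq_of_testBit_eq
    intro i
    simp [testBit_maskOf, h i]

/-- The positions of the binary digits `1` of `n`. -/
def bitsOf (n : ℕ) : List ℕ := (List.range n).filter fun i => n.testBit i

theorem mem_bitsOf {n i : ℕ} : i ∈ bitsOf n ↔ n.testBit i = true := by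
  simp only [bitsOf, List.mem_filter, List.mem_range, and_iff_right_iff_imp]
  intro h
  exact lt_of_lt_of_le Nat.lt_two_pow_self (Nat.ge_two_pow_of_testBit h)

/-- The sum `A + B` dominates both arguments. All bounds for paired states have this shape. -/
theorem pair_lt_add_sq {a b A B : ℕ} (ha : a < A) (hb : b < B) :
    Nat.pair a b < (A + B) ^ 2 := by
  refine (Nat.pair_lt_max_add_one_sq a b).trans_le (Nat.pow_le_pow_left ?_ 2)
  have := max_le (show a ≤ A + B - 1 by omega) (show b ≤ A + B - 1 by omega)
  omega

/-! ### Slices as finite data -/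

/-- An edge of a slice as finite data. -/
abbrev EdgeCode (Γ₂ : Type v) : Type v := Option (ℕ × ℕ) × Option (ℕ × ℕ) × Γ₂

/-- The codomain of `UnitSlice.code`. -/
abbrev SliceCode (Γ₁ : Type u) (Γ₂ : Type v) : Type (max u v) :=
  ℕ × Option Γ₁ × List (List ℕ) × List (EdgeCode Γ₂)

variable {Γ₁ : Type u} {Γ₂ : Type v}

/-- The edges whose index is marked in `m`. -/
def markedEdges (L : List (EdgeCode Γ₂)) (m : ℕ) : List (EdgeCode Γ₂) :=
  (List.range L.length).filterMap fun i => bif m.testBit i then L[i]? else none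

section Encoded

variable [Encodable Γ₁] [Encodable Γ₂]

/-- The record of an endpoint `w` in frontier `j` of an edge with orientation `d` and label `l`. -/
def endMark (w : Option (ℕ × ℕ)) (j d l : ℕ) : List ℕ :=
  (w.bind fun x => bif x.1 == j then some (Nat.pair x.2 (Nat.pair d l)) else none).toList

/-- The records of the endpoints of an edge in frontier `j`, the orientation being that of the
tree: `1` for upwards, `0` for downwards. -/
def endMarks (j : ℕ) (e : EdgeCode Γ₂) : List ℕ :=
  endMark e.1 j (bif j == 0 then 0 else 1) (Encodable.encode e.2.2) ++
    endMark e.2.1 j (bif j == 0 then 1 else 0) (Encodable.encode e.2.2)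

/-- The interface at frontier `j` of the edges marked in `m`. -/
def tile (S : SliceCode Γ₁ Γ₂) (m j : ℕ) : ℕ :=
  maskOf ((markedEdges S.2.2.2 m).flatMap fun e => endMarks j e)

/-- One step of the automaton that compares the interfaces of marked edges; `0` is failure. -/
def tileStep (S : SliceCode Γ₁ Γ₂) (m : ℕ) (qs : List ℕ) : ℕ :=
  bif qs == (List.range qs.length).map fun j => tile S m (j + 1) + 1 then tile S m 0 + 1 else 0

/-- The mask of all edges. -/
def fullMask (S : SliceCode Γ₁ Γ₂) : ℕ := 2 ^ S.2.2.2.length - 1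

/-- The number of marked objects at a slice: center vertices for the tag `13`, edges starting in
the center otherwise. -/
def countMarks (t : ℕ) (S : SliceCode Γ₁ Γ₂) (m : ℕ) : ℕ :=
  bif t == 13 then (bif S.2.1.isSome && m.testBit 0 then 1 else 0)
  else ((List.range S.2.2.2.length).filter fun i =>
    m.testBit i && (S.2.2.2[i]?.map fun e => !e.1.isSome) == some true).length

/-- One step of the automaton that checks that a marking represents a value of a variable. -/
def guardStep (t : ℕ) (S : SliceCode Γ₁ Γ₂) (m : ℕ) (qs : List ℕ) : ℕ :=
  Nat.pair (min 2 (countMarks t S m + (qs.map fun q => q.unpair.1).sum))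
    (tileStep S m (qs.map fun q => q.unpair.2))

/-- The final states of `guardStep`, depending on the sort of the variable. -/
def guardFinal (t q : ℕ) : Bool :=
  t == 15 || (t == 13 && q.unpair.1 == 1) || (t == 14 && q.unpair.1 == 1 && !(q.unpair.2 == 0)) ||
    (t == 16 && !(q.unpair.2 == 0))

/-- The mask assigned to a variable. -/
def envGet (σ : List (ℕ × ℕ)) (k x : ℕ) : ℕ := (σ.lookup (Nat.pair k x)).getD 0

/-- The local condition whose occurrence at some position is what an atomic formula (or, for
equality of sets, its negation) says. -/
def localCheck (t r : ℕ) (S : SliceCode Γ₁ Γ₂) (σ : List (ℕ × ℕ)) : Bool :=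
  let a := r.unpair.1
  let b := r.unpair.2
  let L := S.2.2.2
  (t == 0 && S.2.1.isSome && (envGet σ 13 a).testBit 0 && (envGet σ 15 b).testBit 0) ||
  (t == 1 && (List.range L.length).any fun i =>
    (envGet σ 14 a).testBit i && (envGet σ 16 b).testBit i) ||
  (t == 2 && S.2.1.isSome && (envGet σ 13 a).testBit 0 && (envGet σ 13 b).testBit 0) ||
  (t == 3 && (List.range L.length).any fun i =>
    (envGet σ 14 a).testBit i && (envGet σ 14 b).testBit i) ||
  (t == 4 && S.2.1.isSome && xor ((envGet σ 15 a).testBit 0) ((envGet σ 15 b).testBit 0)) ||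
  (t == 5 && (List.range L.length).any fun i =>
    xor ((envGet σ 16 a).testBit i) ((envGet σ 16 b).testBit i)) ||
  (t == 6 && S.2.1.isSome && (envGet σ 13 b).testBit 0 &&
    (markedEdges L (envGet σ 14 a)).any fun e => !e.1.isSome) ||
  (t == 7 && S.2.1.isSome && (envGet σ 13 b).testBit 0 &&
    (markedEdges L (envGet σ 14 a)).any fun e => !e.2.1.isSome) ||
  (t == 8 && (envGet σ 13 a).testBit 0 && (S.2.1.map fun l => Encodable.encode l) == some b) ||
  (t == 9 && (markedEdges L (envGet σ 14 a)).any fun e =>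
    !e.1.isSome && Encodable.encode e.2.2 == b)

/-- The choices of a marking of a slice and of members of the sets of states of its children. -/
def choices (S : SliceCode Γ₁ Γ₂) (qs : List ℕ) : List (ℕ × List ℕ) :=
  (List.range (2 ^ (S.2.2.2.length + 1))).flatMap fun m =>
    (qs.map bitsOf).sections.map fun ps => (m, ps)

end Encoded

/-! ### Recursion on formula codes: transitions, final states, state bounds -/

/-- Tag plus content is at most the code, so a positive tag makes the content strictly smaller.
Composite formulas have tags from 10 on, which makes the recursions below terminate on arbitrary
numbers, including those that code no formula. -/
theorem unpair_snd_lt {k : ℕ} (h : 10 ≤ k.unpair.1) : k.unpair.2 < k := by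
  have := Nat.add_le_pair k.unpair.1 k.unpair.2
  rw [Nat.pair_unpair] at this
  omega

theorem unpair_snd_fst_lt {k : ℕ} (h : 10 ≤ k.unpair.1) : k.unpair.2.unpair.1 < k :=
  (Nat.unpair_left_le _).trans_lt (unpair_snd_lt h)

theorem unpair_snd_snd_lt {k : ℕ} (h : 10 ≤ k.unpair.1) : k.unpair.2.unpair.2 < k :=
  (Nat.unpair_right_le _).trans_lt (unpair_snd_lt h)

/-- The transition function of the automaton of the formula with code `k`, on slices with an
assignment `σ` of masks to variables. -/
def step [Encodable Γ₁] [Encodable Γ₂] (k : ℕ) (S : SliceCode Γ₁ Γ₂) (σ : List (ℕ × ℕ))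
    (qs : List ℕ) : ℕ :=
  if _h : k.unpair.1 < 10 then
    bif localCheck k.unpair.1 k.unpair.2 S σ || qs.any (fun q => q == 1) then 1 else 0
  else if k.unpair.1 < 12 then
    Nat.pair (step k.unpair.2.unpair.1 S σ (qs.map fun q => q.unpair.1))
      (step k.unpair.2.unpair.2 S σ (qs.map fun q => q.unpair.2))
  else if k.unpair.1 < 13 then step k.unpair.2 S σ qs
  else
    maskOf ((choices S qs).map fun x =>
      Nat.pair (guardStep k.unpair.1 S x.1 (x.2.map fun q => q.unpair.1))
        (step k.unpair.2.unpair.2 S ((Nat.pair k.unpair.1 k.unpair.2.unpair.1, x.1) :: σ)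
          (x.2.map fun q => q.unpair.2)))
termination_by k
decreasing_by
  · exact unpair_snd_fst_lt (by omega)
  · exact unpair_snd_snd_lt (by omega)
  · exact unpair_snd_lt (by omega)
  · exact unpair_snd_snd_lt (by omega)

/-- The final states of the automaton of the formula with code `k`. -/
def isFinal (k q : ℕ) : Bool :=
  if _h : k.unpair.1 < 10 then
    bif k.unpair.1 == 4 || k.unpair.1 == 5 then q == 0 else q == 1
  else if k.unpair.1 < 11 then
    isFinal k.unpair.2.unpair.1 q.unpair.1 || isFinal k.unpair.2.unpair.2 q.unpair.2
  else if k.unpair.1 < 12 then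
    isFinal k.unpair.2.unpair.1 q.unpair.1 && isFinal k.unpair.2.unpair.2 q.unpair.2
  else if k.unpair.1 < 13 then !isFinal k.unpair.2 q
  else (bitsOf q).any fun q' =>
    guardFinal k.unpair.1 q'.unpair.1 && isFinal k.unpair.2.unpair.2 q'.unpair.2
termination_by k
decreasing_by
  · exact unpair_snd_fst_lt (by omega)
  · exact unpair_snd_snd_lt (by omega)
  · exact unpair_snd_fst_lt (by omega)
  · exact unpair_snd_snd_lt (by omega)
  · exact unpair_snd_lt (by omega)
  · exact unpair_snd_snd_lt (by omega)

/-- A bound for the records of endpoints in slices of extra-width at most `c`, the edge labels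
having codes less than `B`. -/
def markBound (B c : ℕ) : ℕ := (c + 1 + (B + 2) ^ 2) ^ 2

/-- A bound for the states of `tileStep`. -/
def tileBound (B c : ℕ) : ℕ := 2 ^ markBound B c + 1

/-- A bound for the states of `guardStep`. -/
def guardBound (B c : ℕ) : ℕ := (3 + tileBound B c) ^ 2

/-- A bound for the states of `step k`. -/
def stateBound (B c k : ℕ) : ℕ :=
  if _h : k.unpair.1 < 10 then 2
  else if k.unpair.1 < 12 then
    (stateBound B c k.unpair.2.unpair.1 + stateBound B c k.unpair.2.unpair.2) ^ 2
  else if k.unpair.1 < 13 then stateBound B c k.unpair.2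
  else 2 ^ (guardBound B c + stateBound B c k.unpair.2.unpair.2) ^ 2
termination_by k
decreasing_by
  · exact unpair_snd_fst_lt (by omega)
  · exact unpair_snd_snd_lt (by omega)
  · exact unpair_snd_lt (by omega)
  · exact unpair_snd_snd_lt (by omega)

/-- The transition function of the automaton that checks gluing and the formula with code `k`. -/
def jointStep [Encodable Γ₁] [Encodable Γ₂] (k : ℕ) (S : SliceCode Γ₁ Γ₂) (qs : List ℕ) : ℕ :=
  Nat.pair (tileStep S (fullMask S) (qs.map fun q => q.unpair.1))
    (step k S [] (qs.map fun q => q.unpair.2))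

/-- The final states of the automaton that checks gluing and the formula with code `k`. -/
def jointFinal (k q : ℕ) : Bool := q.unpair.1 == 1 && isFinal k q.unpair.2

/-- The number of states of the automaton that checks gluing and the formula with code `k`. -/
def jointBound (B c k : ℕ) : ℕ := (tileBound B c + stateBound B c k) ^ 2

/-! ### Primitive recursiveness -/

section Primrec

attribute [local fun_prop] Primrec

/-! ### Closure properties of primitive recursive functions, in the pointwise form used by
`fun_prop` -/

namespace PrimrecComp

variable {α β γ δ : Type*} [Primcodable α] [Primcodable β] [Primcodable γ] [Primcodable δ]

theorem id' : Primrec (fun x : α => x) := Primrec.id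

theorem const' (b : β) : Primrec (fun _ : α => b) := Primrec.const b

theorem comp' {f : β → γ} {g : α → β} (hf : Primrec f) (hg : Primrec g) :
    Primrec (fun x => f (g x)) := hf.comp hg

theorem mk {f : α → β} {g : α → γ} (hf : Primrec f) (hg : Primrec g) :
    Primrec (fun x => (f x, g x)) := hf.pair hg

theorem fst {f : α → β × γ} (hf : Primrec f) : Primrec (fun x => (f x).1) := Primrec.fst.comp hf

theorem snd {f : α → β × γ} (hf : Primrec f) : Primrec (fun x => (f x).2) := Primrec.snd.comp hf

theorem add {f g : α → ℕ} (hf : Primrec f) (hg : Primrec g) : Primrec (fun x => f x + g x) :=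
  Primrec.nat_add.comp hf hg

theorem sub {f g : α → ℕ} (hf : Primrec f) (hg : Primrec g) : Primrec (fun x => f x - g x) :=
  Primrec.nat_sub.comp hf hg

theorem div {f g : α → ℕ} (hf : Primrec f) (hg : Primrec g) : Primrec (fun x => f x / g x) :=
  Primrec.nat_div.comp hf hg

theorem mod {f g : α → ℕ} (hf : Primrec f) (hg : Primrec g) : Primrec (fun x => f x % g x) :=
  Primrec.nat_mod.comp hf hg

theorem min {f g : α → ℕ} (hf : Primrec f) (hg : Primrec g) : Primrec (fun x => min (f x) (g x)) :=
  Primrec.nat_min.comp hf hg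

theorem pow {f g : α → ℕ} (hf : Primrec f) (hg : Primrec g) : Primrec (fun x => f x ^ g x) :=
  (Primrec₂.unpaired'.1 Nat.Primrec.pow).comp hf hg

theorem natPair {f g : α → ℕ} (hf : Primrec f) (hg : Primrec g) :
    Primrec (fun x => Nat.pair (f x) (g x)) :=
  Primrec₂.natPair.comp hf hg

theorem natUnpair {f : α → ℕ} (hf : Primrec f) : Primrec (fun x => (f x).unpair) :=
  Primrec.unpair.comp hf

theorem and' {f g : α → Bool} (hf : Primrec f) (hg : Primrec g) : Primrec (fun x => f x && g x) :=
  Primrec.and.comp hf hg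

theorem or' {f g : α → Bool} (hf : Primrec f) (hg : Primrec g) : Primrec (fun x => f x || g x) :=
  Primrec.or.comp hf hg

theorem not' {f : α → Bool} (hf : Primrec f) : Primrec (fun x => !f x) :=
  Primrec.not.comp hf

theorem xor' {f g : α → Bool} (hf : Primrec f) (hg : Primrec g) :
    Primrec (fun x => xor (f x) (g x)) :=
  (Primrec.dom_bool₂ xor).comp hf hg

theorem beq' [BEq β] [LawfulBEq β] {f g : α → β} (hf : Primrec f) (hg : Primrec g) :
    Primrec (fun x => f x == g x) := by
  classical
  exact (Primrec.eq.decide.comp hf hg).of_eq fun x => by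
    by_cases h : f x = g x <;> simp [h]

theorem cond' {c : α → Bool} {f g : α → β} (hc : Primrec c) (hf : Primrec f) (hg : Primrec g) :
    Primrec (fun x => bif c x then f x else g x) := Primrec.cond hc hf hg

theorem iteLt {a b : α → ℕ} {f g : α → β} (ha : Primrec a) (hb : Primrec b)
    (hf : Primrec f) (hg : Primrec g) : Primrec (fun x => if a x < b x then f x else g x) :=
  Primrec.ite (Primrec.nat_lt.comp ha hb) hf hg

theorem some' {f : α → β} (hf : Primrec f) : Primrec (fun x => some (f x)) :=
  Primrec.option_some.comp hf

theorem isSome {f : α → Option β} (hf : Primrec f) : Primrec (fun x => (f x).isSome) :=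
  Primrec.option_isSome.comp hf

theorem optionBind {f : α → Option β} {g : α → β → Option γ} (hf : Primrec f)
    (hg : Primrec fun x : α × β => g x.1 x.2) : Primrec (fun x => (f x).bind fun y => g x y) :=
  Primrec.option_bind hf hg

theorem optionMap {f : α → Option β} {g : α → β → γ} (hf : Primrec f)
    (hg : Primrec fun x : α × β => g x.1 x.2) : Primrec (fun x => (f x).map fun y => g x y) :=
  Primrec.option_map hf hg

theorem optionGetD {f : α → Option β} {g : α → β} (hf : Primrec f) (hg : Primrec g) :
    Primrec (fun x => (f x).getD (g x)) := Primrec.option_getD.comp hf hg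

theorem optionToList {f : α → Option β} (hf : Primrec f) : Primrec (fun x => (f x).toList) :=
  Primrec.optionToList.comp hf

theorem encode' {f : α → β} (hf : Primrec f) : Primrec (fun x => Encodable.encode (f x)) :=
  Primrec.encode.comp hf

theorem cons' {f : α → β} {g : α → List β} (hf : Primrec f) (hg : Primrec g) :
    Primrec (fun x => f x :: g x) := Primrec.list_cons.comp hf hg

theorem append' {f g : α → List β} (hf : Primrec f) (hg : Primrec g) :
    Primrec (fun x => f x ++ g x) := Primrec.list_append.comp hf hg

theorem listMap {f : α → List β} {g : α → β → γ} (hf : Primrec f)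
    (hg : Primrec fun x : α × β => g x.1 x.2) : Primrec (fun x => (f x).map fun y => g x y) :=
  Primrec.list_map hf hg

theorem flatMap {f : α → List β} {g : α → β → List γ} (hf : Primrec f)
    (hg : Primrec fun x : α × β => g x.1 x.2) : Primrec (fun x => (f x).flatMap fun y => g x y) :=
  Primrec.list_flatMap hf hg

theorem filterMap {f : α → List β} {g : α → β → Option γ} (hf : Primrec f)
    (hg : Primrec fun x : α × β => g x.1 x.2) :
    Primrec (fun x => (f x).filterMap fun y => g x y) :=
  Primrec.listFilterMap hf hg

theorem filter {f : α → List β} {g : α → β → Bool} (hf : Primrec f)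
    (hg : Primrec fun x : α × β => g x.1 x.2) : Primrec (fun x => (f x).filter fun y => g x y) :=
  (filterMap (g := fun x y => bif g x y then some y else none) hf
    (cond' hg (some' (snd id')) (const' none))).of_eq fun x => by
      rw [← List.filterMap_eq_filter]
      congr 1
      funext y
      by_cases h : g x y <;> simp [Option.guard, h]

theorem foldr {f : α → List β} {g : α → γ} {h : α → β → γ → γ} (hf : Primrec f) (hg : Primrec g)
    (hh : Primrec fun x : α × β × γ => h x.1 x.2.1 x.2.2) :
    Primrec (fun x => (f x).foldr (fun y z => h x y z) (g x)) :=
  Primrec.list_foldr hf hg (h := fun a p => h a p.1 p.2) hh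

theorem any {f : α → List β} {g : α → β → Bool} (hf : Primrec f)
    (hg : Primrec fun x : α × β => g x.1 x.2) : Primrec (fun x => (f x).any fun y => g x y) :=
  (foldr (h := fun x y z => g x y || z) hf (const' false)
    (or' (comp' hg (mk (fst id') (fst (snd id')))) (snd (snd id')))).of_eq fun x => by
      induction f x <;> simp [*]

theorem sum {f : α → List ℕ} (hf : Primrec f) : Primrec (fun x => (f x).sum) :=
  foldr (h := fun _ y z => y + z) hf (const' 0) (add (fst (snd id')) (snd (snd id')))

theorem range {f : α → ℕ} (hf : Primrec f) : Primrec (fun x => List.range (f x)) :=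
  Primrec.list_range.comp hf

theorem length {f : α → List β} (hf : Primrec f) : Primrec (fun x => (f x).length) :=
  Primrec.list_length.comp hf

theorem getElem?' {f : α → List β} {g : α → ℕ} (hf : Primrec f) (hg : Primrec g) :
    Primrec (fun x => (f x)[g x]?) := Primrec.list_getElem?.comp hf hg

theorem sections {f : α → List (List β)} (hf : Primrec f) : Primrec (fun x => (f x).sections) :=
  (foldr (h := fun _ l s => s.flatMap fun z => l.map fun a => a :: z) hf (const' [[]])
    (flatMap (snd (snd id')) (listMap (fst (snd (fst id')))
      (cons' (snd id') (snd (fst id')))))).of_eq fun x => by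
      induction f x with
      | nil => rfl
      | cons l L ih => rw [List.foldr_cons, ih]; rfl

theorem lookup {f : α → List (ℕ × β)} {g : α → ℕ} (hf : Primrec f) (hg : Primrec g) :
    Primrec (fun x => (f x).lookup (g x)) :=
  (Primrec.listLookup.comp hg hf).of_eq fun x => by
    induction f x with
    | nil => rfl
    | cons p L ih => simp only [List.lookup]

theorem testBit {f g : α → ℕ} (hf : Primrec f) (hg : Primrec g) :
    Primrec (fun x => (f x).testBit (g x)) :=
  (beq' (mod (div hf (pow (const' 2) hg)) (const' 2)) (const' 1)).of_eq fun x => by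
    rw [Nat.testBit_eq_decide_div_mod_eq]; rfl

end PrimrecComp

attribute [local fun_prop] PrimrecComp.id' PrimrecComp.const' PrimrecComp.comp' PrimrecComp.mk
  PrimrecComp.fst PrimrecComp.snd PrimrecComp.add PrimrecComp.sub PrimrecComp.min PrimrecComp.pow
  PrimrecComp.natPair PrimrecComp.natUnpair PrimrecComp.and' PrimrecComp.or' PrimrecComp.not'
  PrimrecComp.xor' PrimrecComp.beq' PrimrecComp.cond' PrimrecComp.iteLt PrimrecComp.some'
  PrimrecComp.isSome
  PrimrecComp.optionBind PrimrecComp.optionMap PrimrecComp.optionGetD PrimrecComp.optionToList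
  PrimrecComp.encode' PrimrecComp.cons' PrimrecComp.append' PrimrecComp.listMap
  PrimrecComp.flatMap PrimrecComp.filterMap PrimrecComp.filter PrimrecComp.foldr PrimrecComp.any
  PrimrecComp.sum PrimrecComp.range PrimrecComp.length PrimrecComp.getElem?'
  PrimrecComp.sections PrimrecComp.lookup PrimrecComp.testBit

/-! ### Primitive recursiveness of the functions that define the automata -/

variable {Γ₁ : Type u} {Γ₂ : Type v} [Primcodable Γ₁] [Primcodable Γ₂]
variable {α : Type*} [Primcodable α]

@[local fun_prop]
theorem primrec_maskOf {f : α → List ℕ} (hf : Primrec f) : Primrec fun x => maskOf (f x) := by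
  unfold maskOf; fun_prop

@[local fun_prop]
theorem primrec_bitsOf {f : α → ℕ} (hf : Primrec f) : Primrec fun x => bitsOf (f x) := by
  unfold bitsOf; fun_prop

@[local fun_prop]
theorem primrec_markedEdges {f : α → List (EdgeCode Γ₂)} {g : α → ℕ} (hf : Primrec f)
    (hg : Primrec g) : Primrec fun x => markedEdges (f x) (g x) := by
  unfold markedEdges; fun_prop

@[local fun_prop]
theorem primrec_endMarks {f : α → ℕ} {g : α → EdgeCode Γ₂} (hf : Primrec f)
    (hg : Primrec g) : Primrec fun x => endMarks (f x) (g x) := by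
  unfold endMarks endMark; fun_prop

@[local fun_prop]
theorem primrec_tile {f : α → SliceCode Γ₁ Γ₂} {g h : α → ℕ} (hf : Primrec f)
    (hg : Primrec g) (hh : Primrec h) : Primrec fun x => tile (f x) (g x) (h x) := by
  unfold tile; fun_prop

@[local fun_prop]
theorem primrec_tileStep {f : α → SliceCode Γ₁ Γ₂} {g : α → ℕ} {h : α → List ℕ} (hf : Primrec f)
    (hg : Primrec g) (hh : Primrec h) : Primrec fun x => tileStep (f x) (g x) (h x) := by
  unfold tileStep; fun_prop

@[local fun_prop]
theorem primrec_fullMask {f : α → SliceCode Γ₁ Γ₂} (hf : Primrec f) :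
    Primrec fun x => fullMask (f x) := by
  unfold fullMask; fun_prop

@[local fun_prop]
theorem primrec_countMarks {t : α → ℕ} {f : α → SliceCode Γ₁ Γ₂} {g : α → ℕ} (ht : Primrec t)
    (hf : Primrec f) (hg : Primrec g) : Primrec fun x => countMarks (t x) (f x) (g x) := by
  unfold countMarks; fun_prop

@[local fun_prop]
theorem primrec_guardStep {t : α → ℕ} {f : α → SliceCode Γ₁ Γ₂} {g : α → ℕ} {h : α → List ℕ}
    (ht : Primrec t) (hf : Primrec f) (hg : Primrec g) (hh : Primrec h) :
    Primrec fun x => guardStep (t x) (f x) (g x) (h x) := by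
  unfold guardStep; fun_prop

@[local fun_prop]
theorem primrec_guardFinal {t q : α → ℕ} (ht : Primrec t) (hq : Primrec q) :
    Primrec fun x => guardFinal (t x) (q x) := by
  unfold guardFinal; fun_prop

@[local fun_prop]
theorem primrec_envGet {f : α → List (ℕ × ℕ)} {g h : α → ℕ} (hf : Primrec f)
    (hg : Primrec g) (hh : Primrec h) : Primrec fun x => envGet (f x) (g x) (h x) := by
  unfold envGet; fun_prop

@[local fun_prop]
theorem primrec_localCheck {t r : α → ℕ} {f : α → SliceCode Γ₁ Γ₂} {g : α → List (ℕ × ℕ)}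
    (ht : Primrec t) (hr : Primrec r) (hf : Primrec f) (hg : Primrec g) :
    Primrec fun x => localCheck (t x) (r x) (f x) (g x) := by
  unfold localCheck; fun_prop

@[local fun_prop]
theorem primrec_choices {f : α → SliceCode Γ₁ Γ₂} {g : α → List ℕ} (hf : Primrec f)
    (hg : Primrec g) : Primrec fun x => choices (f x) (g x) := by
  unfold choices
  have : Primrec fun x => (g x).map bitsOf := by fun_prop
  fun_prop

/-- The recursive calls of `step`, with the states of the guard. -/
def stepCalls (x : ℕ × ℕ × SliceCode Γ₁ Γ₂ × List (ℕ × ℕ) × List ℕ) :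
    List (ℕ × ℕ × SliceCode Γ₁ Γ₂ × List (ℕ × ℕ) × List ℕ) :=
  let k := x.2.1
  let S := x.2.2.1
  let σ := x.2.2.2.1
  let qs := x.2.2.2.2
  if k.unpair.1 < 10 then []
  else if k.unpair.1 < 12 then
    [(0, k.unpair.2.unpair.1, S, σ, qs.map fun q => q.unpair.1),
      (0, k.unpair.2.unpair.2, S, σ, qs.map fun q => q.unpair.2)]
  else if k.unpair.1 < 13 then [(0, k.unpair.2, S, σ, qs)]
  else (choices S qs).map fun y =>
    (guardStep k.unpair.1 S y.1 (y.2.map fun q => q.unpair.1), k.unpair.2.unpair.2, S,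
      (Nat.pair k.unpair.1 k.unpair.2.unpair.1, y.1) :: σ, y.2.map fun q => q.unpair.2)

/-- The value of `step` in terms of the values of the recursive calls. -/
def stepCombine (x : ℕ × ℕ × SliceCode Γ₁ Γ₂ × List (ℕ × ℕ) × List ℕ) (l : List ℕ) : ℕ :=
  let k := x.2.1
  let S := x.2.2.1
  let σ := x.2.2.2.1
  let qs := x.2.2.2.2
  Nat.pair x.1
    (if k.unpair.1 < 10 then
      bif localCheck k.unpair.1 k.unpair.2 S σ || qs.any (fun q => q == 1) then 1 else 0
    else if k.unpair.1 < 12 then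
      Nat.pair (l[0]?.getD 0).unpair.2 (l[1]?.getD 0).unpair.2
    else if k.unpair.1 < 13 then (l[0]?.getD 0).unpair.2
    else maskOf l)

theorem primrec_stepCalls : Primrec (stepCalls (Γ₁ := Γ₁) (Γ₂ := Γ₂)) := by
  unfold stepCalls; fun_prop

theorem primrec_stepCombine : Primrec₂ (stepCombine (Γ₁ := Γ₁) (Γ₂ := Γ₂)) := by
  unfold Primrec₂ stepCombine; fun_prop

theorem stepCalls_lt (x : ℕ × ℕ × SliceCode Γ₁ Γ₂ × List (ℕ × ℕ) × List ℕ) :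
    ∀ y ∈ stepCalls x, y.2.1 < x.2.1 := by
  rcases x with ⟨w, k, S, σ, qs⟩
  intro b' hb'
  simp only [stepCalls] at hb'
  split_ifs at hb' with h1 h2 h3
  · simp at hb'
  · simp only [List.mem_cons, List.not_mem_nil, or_false] at hb'
    rcases hb' with rfl | rfl
    · exact unpair_snd_fst_lt (by omega)
    · exact unpair_snd_snd_lt (by omega)
  · simp only [List.mem_cons, List.not_mem_nil, or_false] at hb'
    subst hb'
    exact unpair_snd_lt (by omega)
  · obtain ⟨y, -, rfl⟩ := List.mem_map.1 hb'
    exact unpair_snd_snd_lt (by omega)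

theorem stepCombine_stepCalls (x : ℕ × ℕ × SliceCode Γ₁ Γ₂ × List (ℕ × ℕ) × List ℕ) :
    stepCombine x ((stepCalls x).map fun x =>
      Nat.pair x.1 (step x.2.1 x.2.2.1 x.2.2.2.1 x.2.2.2.2)) =
    Nat.pair x.1 (step x.2.1 x.2.2.1 x.2.2.2.1 x.2.2.2.2) := by
  rcases x with ⟨w, k, S, σ, qs⟩
  rw [step]
  simp only [stepCalls, stepCombine]
  split_ifs with h1 h2 h3
  · rfl
  · simp
  · simp
  · rw [List.map_map]; rfl

/-- Course-of-values recursion on the formula code. The combining function receives the values of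
the recursive calls but not their arguments, so each call carries its guard state along and returns
it paired with its value. In the quantifier case the list of returned values is then exactly the
list to be turned into a mask. -/
theorem primrec_pair_step :
    Primrec fun x : ℕ × ℕ × SliceCode Γ₁ Γ₂ × List (ℕ × ℕ) × List ℕ =>
      Nat.pair x.1 (step x.2.1 x.2.2.1 x.2.2.2.1 x.2.2.2.2) :=
  Primrec.nat_omega_rec' _ (m := fun x => x.2.1) (Primrec.fst.comp Primrec.snd) primrec_stepCalls
    (g := fun x l => some (stepCombine x l)) (PrimrecComp.some' primrec_stepCombine)
    stepCalls_lt fun x => congrArg some (stepCombine_stepCalls x)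

theorem primrec_step : Primrec fun x : ℕ × SliceCode Γ₁ Γ₂ × List (ℕ × ℕ) × List ℕ =>
    step x.1 x.2.1 x.2.2.1 x.2.2.2 := by
  have h := primrec_pair_step.comp (Primrec.pair (Primrec.const 0)
    (Primrec.id (α := ℕ × SliceCode Γ₁ Γ₂ × List (ℕ × ℕ) × List ℕ)))
  refine (Primrec.snd.comp (Primrec.unpair.comp h)).of_eq fun x => ?_
  rw [Nat.unpair_pair]
  rfl

/-- The recursive calls of `isFinal`, with the verdicts of the guard. -/
def isFinalCalls (x : Bool × ℕ × ℕ) : List (Bool × ℕ × ℕ) :=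
  let k := x.2.1
  let q := x.2.2
  if k.unpair.1 < 10 then []
  else if k.unpair.1 < 12 then
    [(true, k.unpair.2.unpair.1, q.unpair.1), (true, k.unpair.2.unpair.2, q.unpair.2)]
  else if k.unpair.1 < 13 then [(true, k.unpair.2, q)]
  else (bitsOf q).map fun q' =>
    (guardFinal k.unpair.1 q'.unpair.1, k.unpair.2.unpair.2, q'.unpair.2)

/-- The value of `isFinal` in terms of the values of the recursive calls. -/
def isFinalCombine (x : Bool × ℕ × ℕ) (l : List Bool) : Bool :=
  let k := x.2.1
  let q := x.2.2
  x.1 &&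
    (if k.unpair.1 < 10 then
      bif k.unpair.1 == 4 || k.unpair.1 == 5 then q == 0 else q == 1
    else if k.unpair.1 < 11 then l[0]?.getD true || l[1]?.getD true
    else if k.unpair.1 < 12 then l[0]?.getD true && l[1]?.getD true
    else if k.unpair.1 < 13 then !l[0]?.getD true
    else l.any fun b => b)

theorem primrec_isFinal : Primrec fun x : ℕ × ℕ => isFinal x.1 x.2 := by
  have hl : Primrec isFinalCalls := by unfold isFinalCalls; fun_prop
  have hg : Primrec₂ isFinalCombine := by unfold Primrec₂ isFinalCombine; fun_prop
  have hm : Primrec fun x : Bool × ℕ × ℕ => x.2.1 := by fun_prop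
  -- Each call returns its value in conjunction with the verdict of the guard, so that a quantifier
  -- only has to form the disjunction of the returned values. The verdict `true` gives back
  -- `isFinal`.
  have key : Primrec fun x : Bool × ℕ × ℕ => x.1 && isFinal x.2.1 x.2.2 := by
    refine Primrec.nat_omega_rec' _ hm hl
      (g := fun x l => some (isFinalCombine x l)) (PrimrecComp.some' hg) ?_ ?_
    · rintro ⟨w, k, q⟩ b' hb'
      simp only [isFinalCalls] at hb'
      split_ifs at hb' with h1 h2 h3
      · simp at hb'
      · simp only [List.mem_cons, List.not_mem_nil, or_false] at hb'
        rcases hb' with rfl | rfl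
        · exact unpair_snd_fst_lt (by omega)
        · exact unpair_snd_snd_lt (by omega)
      · simp only [List.mem_cons, List.not_mem_nil, or_false] at hb'
        subst hb'
        exact unpair_snd_lt (by omega)
      · obtain ⟨y, -, rfl⟩ := List.mem_map.1 hb'
        exact unpair_snd_snd_lt (by omega)
    · rintro ⟨w, k, q⟩
      rw [isFinal]
      simp only [isFinalCalls, isFinalCombine]
      split_ifs with h1 h2 h3 <;> first | omega | simp [List.any_map, Function.comp_def]
  have : Primrec fun x : ℕ × ℕ => (true && isFinal x.1 x.2) :=
    PrimrecComp.comp' key (g := fun x => (true, x)) (by fun_prop)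
  simpa using this

/-- The number `B` depends only on the edge alphabet and is a constant here; `c` is handed down
unchanged while the code decreases. -/
theorem primrec_stateBound (B : ℕ) : Primrec fun x : ℕ × ℕ => stateBound B x.1 x.2 := by
  have hl : Primrec fun x : ℕ × ℕ =>
      if x.2.unpair.1 < 10 then []
      else if x.2.unpair.1 < 12 then
        [(x.1, x.2.unpair.2.unpair.1), (x.1, x.2.unpair.2.unpair.2)]
      else if x.2.unpair.1 < 13 then [(x.1, x.2.unpair.2)]
      else [(x.1, x.2.unpair.2.unpair.2)] := by fun_prop
  have hg : Primrec₂ fun (x : ℕ × ℕ) (l : List ℕ) =>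
      some (if x.2.unpair.1 < 10 then 2
        else if x.2.unpair.1 < 12 then (l[0]?.getD 0 + l[1]?.getD 0) ^ 2
        else if x.2.unpair.1 < 13 then l[0]?.getD 0
        else 2 ^ (guardBound B x.1 + l[0]?.getD 0) ^ 2) := by
    unfold Primrec₂ guardBound tileBound markBound; fun_prop
  have hm : Primrec fun x : ℕ × ℕ => x.2 := by fun_prop
  refine Primrec.nat_omega_rec' _ hm hl hg ?_ ?_
  · rintro ⟨c, k⟩ b' hb'
    dsimp only at hb'
    split_ifs at hb' with h1 h2 h3
    · simp at hb'
    · simp only [List.mem_cons, List.not_mem_nil, or_false] at hb'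
      rcases hb' with rfl | rfl
      · exact unpair_snd_fst_lt (by omega)
      · exact unpair_snd_snd_lt (by omega)
    · simp only [List.mem_cons, List.not_mem_nil, or_false] at hb'
      subst hb'
      exact unpair_snd_lt (by omega)
    · simp only [List.mem_cons, List.not_mem_nil, or_false] at hb'
      subst hb'
      exact unpair_snd_snd_lt (by omega)
  · rintro ⟨c, k⟩
    rw [stateBound]
    dsimp only
    split_ifs with h1 h2 h3 <;> simp

theorem primrec_jointStep_args : Primrec fun x : (ℕ × ℕ) × SliceCode Γ₁ Γ₂ × List ℕ × ℕ =>
    (x.1.1, x.2.1, ([] : List (ℕ × ℕ)), x.2.2.1.map fun q => q.unpair.2) := by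
  fun_prop

theorem primrec_step_map : Primrec fun x : (ℕ × ℕ) × SliceCode Γ₁ Γ₂ × List ℕ × ℕ =>
    step x.1.1 x.2.1 [] (x.2.2.1.map fun q => q.unpair.2) :=
  (primrec_step.comp primrec_jointStep_args).of_eq fun _ => rfl

theorem primrec_tileStep_map : Primrec fun x : (ℕ × ℕ) × SliceCode Γ₁ Γ₂ × List ℕ × ℕ =>
    tileStep x.2.1 (fullMask x.2.1) (x.2.2.1.map fun q => q.unpair.1) := by
  fun_prop

theorem primrec_jointStep : Primrec fun x : (ℕ × ℕ) × SliceCode Γ₁ Γ₂ × List ℕ × ℕ =>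
    x.2.2.2 == jointStep x.1.1 x.2.1 x.2.2.1 :=
  PrimrecComp.beq' (by fun_prop) (PrimrecComp.natPair primrec_tileStep_map primrec_step_map)

theorem primrec_jointFinal : Primrec fun x : (ℕ × ℕ) × ℕ => jointFinal x.1.1 x.2 := by
  have h : Primrec fun x : (ℕ × ℕ) × ℕ => isFinal x.1.1 x.2.unpair.2 :=
    PrimrecComp.comp' primrec_isFinal (g := fun x : (ℕ × ℕ) × ℕ => (x.1.1, x.2.unpair.2))
      (by fun_prop)
  unfold jointFinal
  fun_prop

theorem primrec_jointBound (B : ℕ) : Primrec fun x : ℕ × ℕ => jointBound B x.2 x.1 := by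
  have h : Primrec fun x : ℕ × ℕ => stateBound B x.2 x.1 :=
    PrimrecComp.comp' (primrec_stateBound B) (g := fun x : ℕ × ℕ => (x.2, x.1)) (by fun_prop)
  unfold jointBound tileBound markBound
  fun_prop

end Primrec

/-! ### Runs of deterministic automata on terms -/

namespace Term

variable {F : Type u} {ar : F → ℕ}

/-- The value of a term in the algebra of natural numbers whose operations `δ p` may depend on the
position `p`. -/
def run (δ : List ℕ → F → List ℕ → ℕ) : Term ar → ℕ
  | node f ts => δ [] f (List.ofFn fun i => run (fun p => δ (((i : ℕ) + 1) :: p)) (ts i))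

/-- The symbol at the string of child indices `p`, if `p` is a position. -/
def symbol? (t : Term ar) (p : List ℕ) : Option F := (t.subterm? p).map leading

theorem symbol?_nil (t : Term ar) : t.symbol? [] = some t.leading := by
  cases t; rfl

theorem symbol?_node {f : F} {ts : Fin (ar f) → Term ar} {q : List ℕ} {g : F} :
    (node f ts).symbol? q = some g ↔
      (q = [] ∧ f = g) ∨ ∃ (i : Fin (ar f)) (p : List ℕ), q = ((i : ℕ) + 1) :: p ∧
        (ts i).symbol? p = some g := by
  cases q with
  | nil => simp [symbol?_nil, leading]
  | cons j p =>
    simp only [symbol?, subterm?, reduceCtorEq, false_and, false_or, List.cons.injEq]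
    constructor
    · intro h
      split_ifs at h with hj
      · exact ⟨⟨j - 1, by omega⟩, p, ⟨by simp; omega, rfl⟩, h⟩
      · simp at h
    · rintro ⟨i, p', ⟨rfl, rfl⟩, h⟩
      rw [dif_pos ⟨by omega, by omega⟩]
      exact h

theorem symbol?_node_cons {f : F} {ts : Fin (ar f) → Term ar} (i : Fin (ar f)) (p : List ℕ) :
    (node f ts).symbol? (((i : ℕ) + 1) :: p) = (ts i).symbol? p := by
  simp only [symbol?, subterm?]
  rw [dif_pos ⟨by omega, by omega⟩]
  rfl

theorem symbol?_pos (t : Term ar) (p : t.Pos) : t.symbol? p.1 = some (t.symbolAt p) := by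
  exact congrArg (Option.map leading) (Option.some_get p.2).symm

theorem exists_pos_of_symbol? {t : Term ar} {p : List ℕ} {f : F} (h : t.symbol? p = some f) :
    ∃ p' : t.Pos, p'.1 = p ∧ t.symbolAt p' = f := by
  have hs : (t.subterm? p).isSome := by
    cases hp : t.subterm? p
    · simp [symbol?, hp] at h
    · rfl
  refine ⟨⟨p, hs⟩, rfl, ?_⟩
  have := symbol?_pos t ⟨p, hs⟩
  rw [h] at this
  exact (Option.some.inj this).symm

theorem exists_symbol?_iff {t : Term ar} {P : List ℕ → F → Prop} :
    (∃ p f, t.symbol? p = some f ∧ P p f) ↔ ∃ p : t.Pos, P p.1 (t.symbolAt p) := by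
  constructor
  · rintro ⟨p, f, h, hP⟩
    obtain ⟨p', rfl, rfl⟩ := exists_pos_of_symbol? h
    exact ⟨p', hP⟩
  · rintro ⟨p, hP⟩
    exact ⟨p.1, _, symbol?_pos t p, hP⟩

theorem run_congr {t : Term ar} {δ δ' : List ℕ → F → List ℕ → ℕ}
    (h : ∀ p f, t.symbol? p = some f → ∀ qs, δ p f qs = δ' p f qs) : run δ t = run δ' t := by
  induction t generalizing δ δ' with
  | node f ts ih =>
    simp only [run]
    rw [h [] f rfl]
    congr 2
    funext i
    apply ih
    intro p g hp qs
    exact h _ _ ((symbol?_node_cons i p).trans hp) qs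

theorem run_lt {t : Term ar} {δ : List ℕ → F → List ℕ → ℕ} {N : ℕ}
    (h : ∀ p f, t.symbol? p = some f → ∀ qs, (∀ q ∈ qs, q < N) → δ p f qs < N) :
    run δ t < N := by
  induction t generalizing δ with
  | node f ts ih =>
    simp only [run]
    refine h [] f rfl _ fun q hq => ?_
    obtain ⟨i, rfl⟩ := (List.mem_ofFn' _ _).1 hq
    exact ih i fun p g hp => h _ _ ((symbol?_node_cons i p).trans hp)

/-- The product of two automata computes both runs side by side. -/
theorem run_pair (δ₁ δ₂ : List ℕ → F → List ℕ → ℕ) (t : Term ar) :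
    run (fun p f qs => Nat.pair (δ₁ p f (qs.map fun q => q.unpair.1))
      (δ₂ p f (qs.map fun q => q.unpair.2))) t = Nat.pair (run δ₁ t) (run δ₂ t) := by
  induction t generalizing δ₁ δ₂ with
  | node f ts ih =>
    simp only [run, ih, List.map_ofFn, Function.comp_def, Nat.unpair_pair]

/-- The searching automaton has only the values 0 and 1. Hence the value 0 means that the search
failed, which is what equality of sets needs. -/
theorem run_exists (L : List ℕ → F → Bool) (t : Term ar) :
    run (fun p f qs => bif L p f || qs.any (fun q => q == 1) then 1 else 0) t =
      bif t.run (fun p f qs => bif L p f || qs.any (fun q => q == 1) then 1 else 0) == 1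
        then 1 else 0 := by
  cases t
  simp only [run]
  cases (_ : Bool) || _ <;> rfl

/-- The value 1 is produced where the local condition holds and is then passed up to the root. -/
theorem run_exists_eq_one (L : List ℕ → F → Bool) (t : Term ar) :
    run (fun p f qs => bif L p f || qs.any (fun q => q == 1) then 1 else 0) t = 1 ↔
      ∃ p f, t.symbol? p = some f ∧ L p f = true := by
  induction t generalizing L with
  | node f ts ih =>
    have h1 : ∀ b : Bool, (bif b then 1 else 0) = 1 ↔ b = true := by decide
    simp only [run, h1, Bool.or_eq_true, List.any_eq_true, beq_iff_eq]
    constructor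
    · rintro (h | ⟨q, hq, rfl⟩)
      · exact ⟨[], f, rfl, h⟩
      · obtain ⟨i, hi⟩ := (List.mem_ofFn' _ _).1 hq
        obtain ⟨p, g, hp, hg⟩ := (ih i fun p => L (((i : ℕ) + 1) :: p)).1 hi
        exact ⟨_, g, (symbol?_node_cons i p).trans hp, hg⟩
    · rintro ⟨p, g, hp, hg⟩
      rcases symbol?_node.1 hp with ⟨rfl, rfl⟩ | ⟨i, p, rfl, hs⟩
      · exact Or.inl hg
      · exact Or.inr ⟨1, (List.mem_ofFn' _ _).2
          ⟨i, (ih i fun p => L (((i : ℕ) + 1) :: p)).2 ⟨p, g, hs, hg⟩⟩, rfl⟩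

theorem forall₂_ofFn_right {α β : Type*} {R : α → β → Prop} {n : ℕ} {l : List α}
    {g : Fin n → β} :
    List.Forall₂ R l (List.ofFn g) ↔ ∃ a : Fin n → α, l = List.ofFn a ∧ ∀ i, R (a i) (g i) := by
  constructor
  · intro h
    have hl : l.length = n := by rw [h.length_eq, List.length_ofFn]
    subst hl
    refine ⟨l.get, (List.ofFn_get l).symm, fun i => ?_⟩
    have := (List.forall₂_iff_get.1 h).2 i.1 i.2 (by simp)
    simpa using this
  · rintro ⟨a, rfl, h⟩
    rw [List.forall₂_iff_get]
    exact ⟨by simp, fun i h₁ h₂ => by simpa using h ⟨i, by simpa using h₁⟩⟩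

/-- This is the subset construction. The bits of the state of `Δ` at a subterm are the states that
`δ` can reach there for some family of guesses `m`. Guesses in different subtrees are independent,
so families for the children and a guess at the root combine freely to a family for the whole term.
-/
theorem testBit_run {Δ : List ℕ → F → List ℕ → ℕ} {δ : List ℕ → F → ℕ → List ℕ → ℕ} {b : F → ℕ}
    (t : Term ar)
    (H : ∀ p f Qs q, (Δ p f Qs).testBit q = true ↔ ∃ m < b f, ∃ ps : List ℕ,
      List.Forall₂ (fun a Q => Nat.testBit Q a = true) ps Qs ∧ δ p f m ps = q) (q : ℕ) :
    (run Δ t).testBit q = true ↔ ∃ m : List ℕ → ℕ,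
      (∀ p f, t.symbol? p = some f → m p < b f) ∧ run (fun p f qs => δ p f (m p) qs) t = q := by
  induction t generalizing Δ δ q with
  | node f ts ih =>
    simp only [run, H, forall₂_ofFn_right]
    constructor
    · rintro ⟨m₀, hm₀, ps, ⟨a, rfl, ha⟩, rfl⟩
      have h := fun i => (ih i (fun p => H (((i : ℕ) + 1) :: p)) (a i)).1 (ha i)
      choose m hm hrun using h
      -- Children are numbered from 1, hence `j - 1`. Values at strings that are not positions do
      -- not matter.
      refine ⟨fun p => match p with
        | [] => m₀
        | j :: p => if hj : j - 1 < ar f then m ⟨j - 1, hj⟩ p else 0, ?_, ?_⟩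
      · intro p g hp
        rcases symbol?_node.1 hp with ⟨rfl, rfl⟩ | ⟨i, p, rfl, hs⟩
        · exact hm₀
        · simpa using hm i p g hs
      · simp only [Nat.add_sub_cancel, Fin.is_lt, dite_true, Fin.eta]
        congr 2
        funext i
        exact hrun i
    · rintro ⟨m, hm, rfl⟩
      refine ⟨m [], hm [] f rfl, _, ⟨_, rfl, fun i => ?_⟩, rfl⟩
      exact (ih i (fun p => H (((i : ℕ) + 1) :: p)) _).2
        ⟨fun p => m (((i : ℕ) + 1) :: p), fun p g hp => hm _ g ((symbol?_node_cons i p).trans hp), rfl⟩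

/-- The interface `out` of each position agrees with the interface `inn` at its parent. -/
def Agree (out : List ℕ → F → ℕ) (inn : List ℕ → F → ℕ → ℕ) (t : Term ar) : Prop :=
  ∀ p j f g, t.symbol? p = some f → t.symbol? (p ++ [j]) = some g → out (p ++ [j]) g = inn p f j

theorem agree_node {out : List ℕ → F → ℕ} {inn : List ℕ → F → ℕ → ℕ} {f : F}
    {ts : Fin (ar f) → Term ar} : Agree out inn (node f ts) ↔
      ∀ i : Fin (ar f), out [(i : ℕ) + 1] (ts i).leading = inn [] f ((i : ℕ) + 1) ∧
        Agree (fun p => out (((i : ℕ) + 1) :: p)) (fun p => inn (((i : ℕ) + 1) :: p)) (ts i) := by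
  constructor
  · intro h i
    refine ⟨h [] _ f _ rfl ((symbol?_node_cons i []).trans (symbol?_nil _)), ?_⟩
    intro p j g g' hp hp'
    exact h _ j g g' ((symbol?_node_cons i p).trans hp) ((symbol?_node_cons i _).trans hp')
  · intro h p j g g' hp hp'
    rcases symbol?_node.1 hp with ⟨rfl, rfl⟩ | ⟨i, p, rfl, hs⟩
    · rcases symbol?_node.1 hp' with ⟨h', -⟩ | ⟨i, p, h', hp'⟩
      · simp at h'
      · simp only [List.nil_append, List.cons.injEq] at h'
        obtain ⟨rfl, rfl⟩ := h'
        rw [symbol?_nil] at hp'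
        obtain rfl := Option.some.inj hp'
        exact (h i).1
    · rw [List.cons_append, symbol?_node_cons] at hp'
      exact (h i).2 p j g g' hs hp'

/-- A state announces the out-interface plus one, and 0 stands for failure. Since the expected value
is also shifted by one, it is never 0, so the failure of a child makes the comparison at its parent
fail and reaches the root. -/
theorem run_agree (out : List ℕ → F → ℕ) (inn : List ℕ → F → ℕ → ℕ) (t : Term ar)
    [Decidable (Agree out inn t)] :
    run (fun p f qs => bif qs == (List.range qs.length).map fun j => inn p f (j + 1) + 1
      then out p f + 1 else 0) t = if Agree out inn t then out [] t.leading + 1 else 0 := by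
  classical
  induction t generalizing out inn with
  | node f ts ih =>
    simp only [run, ih, List.length_ofFn]
    rw [show (node f ts).leading = f from rfl]
    set l := List.ofFn fun i : Fin (ar f) =>
      if Agree (fun p => out (((i : ℕ) + 1) :: p)) (fun p => inn (((i : ℕ) + 1) :: p)) (ts i) then
        out [(i : ℕ) + 1] (ts i).leading + 1 else 0 with hl
    have key : (l == (List.range (ar f)).map fun j => inn [] f (j + 1) + 1) =
        decide (Agree out inn (node f ts)) := by
      rw [Bool.eq_iff_iff, beq_iff_eq, decide_eq_true_iff, agree_node]
      have e : ((List.range (ar f)).map fun j => inn [] f (j + 1) + 1) =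
          List.ofFn fun i : Fin (ar f) => inn [] f ((i : ℕ) + 1) + 1 := by
        rw [← List.map_coe_finRange_eq_range, List.map_map, List.ofFn_eq_map]
        rfl
      rw [e, hl, List.ofFn_inj, funext_iff]
      refine forall_congr' fun i => ?_
      split_ifs with h
      · simp [h]
      · simp [h]
    rw [key]
    by_cases h : Agree out inn (node f ts) <;> simp [h]

/-- Marked objects at the positions of a term. -/
def Marked {ι : Type*} (I : List ℕ → F → ι → Prop) (t : Term ar) (x : List ℕ × ι) : Prop :=
  ∃ f, t.symbol? x.1 = some f ∧ I x.1 f x.2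

theorem marked_node {ι : Type*} {I : List ℕ → F → ι → Prop} {f : F} {ts : Fin (ar f) → Term ar}
    {x : List ℕ × ι} : Marked I (node f ts) x ↔
      (x.1 = [] ∧ I [] f x.2) ∨ ∃ (i : Fin (ar f)) (p : List ℕ), x.1 = ((i : ℕ) + 1) :: p ∧
        Marked (fun p => I (((i : ℕ) + 1) :: p)) (ts i) (p, x.2) := by
  rcases x with ⟨q, y⟩
  constructor
  · rintro ⟨g, hg, hI⟩
    rcases symbol?_node.1 hg with ⟨rfl, rfl⟩ | ⟨i, p, h, hp⟩
    · exact Or.inl ⟨rfl, hI⟩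
    · dsimp only at h
      subst h
      exact Or.inr ⟨i, p, rfl, g, hp, hI⟩
  · rintro (⟨h, hI⟩ | ⟨i, p, h, g, hp, hI⟩)
    · dsimp only at h; subst h; exact ⟨f, rfl, hI⟩
    · dsimp only at h; subst h; exact ⟨g, (symbol?_node_cons i p).trans hp, hI⟩

theorem sum_eq_one_iff {n : ℕ} {c : ℕ} {r : Fin n → ℕ} : c + ∑ i, r i = 1 ↔
    (c = 1 ∧ ∀ i, r i = 0) ∨ (c = 0 ∧ ∃ i, r i = 1 ∧ ∀ j ≠ i, r j = 0) := by
  constructor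
  · intro h
    by_cases hr : ∀ i, r i = 0
    · left; simp [hr] at h; exact ⟨h, hr⟩
    · push Not at hr
      obtain ⟨i, hi⟩ := hr
      rw [← Finset.add_sum_erase _ _ (Finset.mem_univ i)] at h
      refine Or.inr ⟨by omega, i, by omega, fun j hj => ?_⟩
      have h0 : ∑ x ∈ Finset.univ.erase i, r x = 0 := by omega
      exact Finset.sum_eq_zero_iff.1 h0 j (by simp [hj])
  · rintro (⟨rfl, h⟩ | ⟨rfl, i, h, h'⟩)
    · simp [h]
    · rw [Finset.sum_eq_single i (fun j _ hj => h' j hj) (by simp), h]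

/-- To recognize a single marked object it is enough to count up to 2. A total of 1 arises either
from the root alone or from exactly one child; the other contributions must be 0, which is why both
equivalences are proved together. -/
theorem run_count {ι : Type*} {I : List ℕ → F → ι → Prop} {cnt : List ℕ → F → ℕ}
    (h₀ : ∀ p f, cnt p f = 0 ↔ ∀ y, ¬ I p f y) (h₁ : ∀ p f, cnt p f = 1 ↔ ∃! y, I p f y)
    (t : Term ar) :
    (run (fun p f qs => min 2 (cnt p f + qs.sum)) t = 0 ↔ ∀ x, ¬ Marked I t x) ∧
    (run (fun p f qs => min 2 (cnt p f + qs.sum)) t = 1 ↔ ∃! x, Marked I t x) := by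
  induction t generalizing I cnt with
  | node f ts ih =>
    have ih' := fun i => ih i (I := fun p => I (((i : ℕ) + 1) :: p))
      (cnt := fun p => cnt (((i : ℕ) + 1) :: p)) (fun p => h₀ _) (fun p => h₁ _)
    simp only [run, List.sum_ofFn]
    set r : Fin (ar f) → ℕ := fun i => run (fun p f qs =>
      min 2 (cnt (((i : ℕ) + 1) :: p) f + qs.sum)) (ts i)
    have e₀ : ∀ n, min 2 n = 0 ↔ n = 0 := by omega
    have e₁ : ∀ n, min 2 n = 1 ↔ n = 1 := by omega
    rw [e₀, e₁, sum_eq_one_iff]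
    constructor
    · simp only [Nat.add_eq_zero_iff, Finset.sum_eq_zero_iff, Finset.mem_univ, true_imp_iff]
      constructor
      · rintro ⟨hc, hr⟩ x hx
        rcases marked_node.1 hx with ⟨-, hI⟩ | ⟨i, p, -, hp⟩
        · exact (h₀ _ _).1 hc _ hI
        · exact (ih' i).1.1 (hr i) _ hp
      · intro h
        refine ⟨(h₀ _ _).2 fun y hy => h ([], y) (marked_node.2 (Or.inl ⟨rfl, hy⟩)), fun i => ?_⟩
        exact (ih' i).1.2 fun x hx => h (((i : ℕ) + 1) :: x.1, x.2)
          (marked_node.2 (Or.inr ⟨i, x.1, rfl, hx⟩))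
    · constructor
      · rintro (⟨hc, hr⟩ | ⟨hc, i, hi, hr⟩)
        · obtain ⟨y, hy, huniq⟩ := (h₁ _ _).1 hc
          refine ⟨([], y), marked_node.2 (Or.inl ⟨rfl, hy⟩), fun x hx => ?_⟩
          rcases marked_node.1 hx with ⟨h, hI⟩ | ⟨i, p, -, hp⟩
          · exact Prod.ext h (huniq _ hI)
          · exact absurd hp ((ih' i).1.1 (hr i) _)
        · obtain ⟨⟨p, y⟩, hy, huniq⟩ := (ih' i).2.1 hi
          refine ⟨(((i : ℕ) + 1) :: p, y), marked_node.2 (Or.inr ⟨i, p, rfl, hy⟩), fun x hx => ?_⟩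
          rcases marked_node.1 hx with ⟨-, hI⟩ | ⟨j, p', h, hp⟩
          · exact absurd hI ((h₀ _ _).1 hc _)
          · by_cases hj : j = i
            · subst hj
              have := huniq _ hp
              simp only [Prod.mk.injEq] at this
              exact Prod.ext (by rw [h, this.1]) this.2
            · exact absurd hp ((ih' j).1.1 (hr j hj) _)
      · rintro ⟨x, hx, huniq⟩
        rcases marked_node.1 hx with ⟨h, hI⟩ | ⟨i, p, h, hp⟩
        · left
          refine ⟨(h₁ _ _).2 ⟨x.2, hI, fun y hy => ?_⟩, fun i => (ih' i).1.2 fun z hz => ?_⟩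
          · exact congrArg Prod.snd (huniq ([], y) (marked_node.2 (Or.inl ⟨rfl, hy⟩)))
          · have := huniq (((i : ℕ) + 1) :: z.1, z.2) (marked_node.2 (Or.inr ⟨i, z.1, rfl, hz⟩))
            rw [← this] at h
            simp at h
        · right
          refine ⟨(h₀ _ _).2 fun y hy => ?_, i, (ih' i).2.2 ⟨(p, x.2), hp, fun z hz => ?_⟩,
            fun j hj => (ih' j).1.2 fun z hz => ?_⟩
          · have := huniq ([], y) (marked_node.2 (Or.inl ⟨rfl, hy⟩))
            rw [← this] at h
            simp at h
          · have := huniq (((i : ℕ) + 1) :: z.1, z.2) (marked_node.2 (Or.inr ⟨i, z.1, rfl, hz⟩))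
            rw [← this] at h ⊢
            simp only [List.cons.injEq, true_and] at h
            exact Prod.ext h rfl
          · have := huniq (((j : ℕ) + 1) :: z.1, z.2) (marked_node.2 (Or.inr ⟨j, z.1, rfl, hz⟩))
            rw [← this] at h
            simp only [List.cons.injEq, add_left_inj, Fin.val_inj] at h
            exact absurd h.1 hj

theorem exists_length_bound (t : Term ar) : ∃ H, ∀ p f, t.symbol? p = some f → p.length ≤ H := by
  induction t with
  | node f ts ih =>
    choose H hH using ih
    refine ⟨(Finset.univ.sup H) + 1, fun p g hp => ?_⟩
    rcases symbol?_node.1 hp with ⟨rfl, -⟩ | ⟨i, p, rfl, hs⟩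
    · simp
    · have := hH i p g hs
      have h2 : H i ≤ Finset.univ.sup H := Finset.le_sup (Finset.mem_univ i)
      simp only [List.length_cons]
      omega

end Term

namespace TreeAutomaton

variable {F : Type u} {ar : F → ℕ}

/-- When the transitions form the graph of a function that does not leave the state set, the reached
state is the value of the term. -/
theorem reaches_iff_run {A : TreeAutomaton ar} {δ : F → List ℕ → ℕ}
    (h : ∀ f qs q, A.trans f qs q ↔ (q : ℕ) = δ f (List.ofFn fun i => (qs i : ℕ)))
    (hlt : ∀ f (qs : List ℕ), (∀ q ∈ qs, q < A.numStates) → δ f qs < A.numStates)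
    (t : Term ar) (q : Fin A.numStates) :
    A.Reaches t q ↔ (q : ℕ) = Term.run (fun _ => δ) t := by
  induction t generalizing q with
  | node f ts ih =>
    simp only [Term.run]
    constructor
    · rintro ⟨_, _, qs, _, hts, hq⟩
      rw [(h _ _ _).1 hq]
      congr 2
      funext i
      exact (ih i _).1 (hts i)
    · intro hq
      have hl := fun i => Term.run_lt (t := ts i) (δ := fun _ => δ) fun _ f _ => hlt f
      refine .node f ts (fun i => ⟨_, hl i⟩) q (fun i => (ih i _).2 rfl) ((h _ _ _).2 hq)

end TreeAutomaton

/-! ### Interfaces of slices -/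

namespace UnitSlice

variable {Γ₁ : Type u} {Γ₂ : Type v}

/-- The edge `e` has the endpoint `[j, i]`; `d` is `1` if it is directed upwards there, `0` if it is
directed downwards. -/
def Mark (S : UnitSlice Γ₁ Γ₂) (j : ℕ) (e : Fin S.numEdges) (i d : ℕ) : Prop :=
  (S.source e = .frontier j i ∧ d = bif j == 0 then 0 else 1) ∨
    (S.target e = .frontier j i ∧ d = bif j == 0 then 1 else 0)

theorem mem_markedEdges {n m : ℕ} {g : Fin n → EdgeCode Γ₂} {x : EdgeCode Γ₂} :
    x ∈ markedEdges (List.ofFn g) m ↔ ∃ e : Fin n, m.testBit e = true ∧ g e = x := by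
  simp only [markedEdges, List.length_ofFn, List.mem_filterMap, List.mem_range]
  constructor
  · rintro ⟨i, hi, h⟩
    cases hb : m.testBit i
    · simp [hb] at h
    · refine ⟨⟨i, hi⟩, hb, ?_⟩
      simpa [hb, hi] using h
  · rintro ⟨e, he, rfl⟩
    exact ⟨e, e.2, by simp [he]⟩

theorem mem_endMark {w : SliceVertex} {j d l a : ℕ} :
    a ∈ endMark w.code j d l ↔ ∃ i, w = .frontier j i ∧ a = Nat.pair i (Nat.pair d l) := by
  cases w with
  | center => simp [endMark, SliceVertex.code]
  | frontier j' i =>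
    by_cases h : j' = j
    · simp [endMark, SliceVertex.code, h]
    · have : (j' == j) = false := by simp [h]
      simp [endMark, SliceVertex.code, h, this]

theorem tile_code [Encodable Γ₁] [Encodable Γ₂] (S : UnitSlice Γ₁ Γ₂) (m j : ℕ) :
    ∃ l : List ℕ, tile S.code m j = maskOf l ∧ ∀ a, a ∈ l ↔
      ∃ e i d, m.testBit (e : Fin S.numEdges) = true ∧ S.Mark j e i d ∧
        a = Nat.pair i (Nat.pair d (Encodable.encode (S.edgeLabel e))) := by
  refine ⟨_, rfl, fun a => ?_⟩
  simp only [List.mem_flatMap, UnitSlice.code, mem_markedEdges, endMarks, List.mem_append]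
  constructor
  · rintro ⟨_, ⟨e, he, rfl⟩, h | h⟩
    · obtain ⟨i, hi, rfl⟩ := mem_endMark.1 h
      exact ⟨e, i, _, he, Or.inl ⟨hi, rfl⟩, rfl⟩
    · obtain ⟨i, hi, rfl⟩ := mem_endMark.1 h
      exact ⟨e, i, _, he, Or.inr ⟨hi, rfl⟩, rfl⟩
  · rintro ⟨e, i, d, he, ⟨hi, rfl⟩ | ⟨hi, rfl⟩, rfl⟩
    · exact ⟨_, ⟨e, he, rfl⟩, Or.inl (mem_endMark.2 ⟨i, hi, rfl⟩)⟩
    · exact ⟨_, ⟨e, he, rfl⟩, Or.inr (mem_endMark.2 ⟨i, hi, rfl⟩)⟩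

theorem tile_eq_tile [Encodable Γ₁] [Encodable Γ₂] {S S' : UnitSlice Γ₁ Γ₂} {m m' j j' : ℕ} :
    tile S.code m j = tile S'.code m' j' ↔ ∀ i d b,
      (∃ e, m.testBit (e : Fin S.numEdges) = true ∧ S.Mark j e i d ∧ S.edgeLabel e = b) ↔
      (∃ e, m'.testBit (e : Fin S'.numEdges) = true ∧ S'.Mark j' e i d ∧ S'.edgeLabel e = b) := by
  obtain ⟨l, hl, hm⟩ := tile_code S m j
  obtain ⟨l', hl', hm'⟩ := tile_code S' m' j'
  rw [hl, hl', maskOf_eq_maskOf]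
  -- Records are coded injectively, so a coded number occurs exactly when the record itself does.
  have aux : ∀ (S : UnitSlice Γ₁ Γ₂) (m j i d : ℕ) (b : Γ₂),
      (∃ e i' d', m.testBit (e : Fin S.numEdges) = true ∧ S.Mark j e i' d' ∧
        Nat.pair i (Nat.pair d (Encodable.encode b)) =
          Nat.pair i' (Nat.pair d' (Encodable.encode (S.edgeLabel e)))) ↔
      ∃ e, m.testBit (e : Fin S.numEdges) = true ∧ S.Mark j e i d ∧ S.edgeLabel e = b := by
    intro S m j i d b
    constructor
    · rintro ⟨e, i', d', he, hM, h⟩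
      simp only [Nat.pair_eq_pair, Encodable.encode_inj] at h
      obtain ⟨rfl, rfl, rfl⟩ := h
      exact ⟨e, he, hM, rfl⟩
    · rintro ⟨e, he, hM, rfl⟩
      exact ⟨e, i, d, he, hM, rfl⟩
  constructor
  · intro h i d b
    rw [← aux, ← aux, ← hm, ← hm']
    exact h _
  · intro h a
    rw [hm, hm']
    constructor
    · rintro ⟨e, i, d, he, hM, rfl⟩
      exact (aux S' m' j' i d _).2 ((h i d _).1 ⟨e, he, hM, rfl⟩)
    · rintro ⟨e, i, d, he, hM, rfl⟩
      exact (aux S m j i d _).2 ((h i d _).2 ⟨e, he, hM, rfl⟩)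

theorem testBit_fullMask (S : UnitSlice Γ₁ Γ₂) (e : Fin S.numEdges) :
    (fullMask S.code).testBit e = true := by
  simp [fullMask, UnitSlice.code]

theorem Mark.incident {S : UnitSlice Γ₁ Γ₂} {j i d : ℕ} {e : Fin S.numEdges}
    (h : S.Mark j e i d) : S.source e = .frontier j i ∨ S.target e = .frontier j i :=
  h.imp And.left And.left

theorem mem_frontier_of_incident {S : UnitSlice Γ₁ Γ₂} {j i : ℕ} {e : Fin S.numEdges}
    (h : S.source e = .frontier j i ∨ S.target e = .frontier j i) : i ∈ S.frontier j := by
  rcases h with h | h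
  · have := S.source_mem e
    rwa [h] at this
  · have := S.target_mem e
    rwa [h] at this

theorem eq_of_incident {S : UnitSlice Γ₁ Γ₂} {j i : ℕ} {e e' : Fin S.numEdges}
    (h : S.source e = .frontier j i ∨ S.target e = .frontier j i)
    (h' : S.source e' = .frontier j i ∨ S.target e' = .frontier j i) : e = e' :=
  (S.existsUnique_edge j i (mem_frontier_of_incident h)).unique h h'

theorem le_arity_of_mem_frontier {S : UnitSlice Γ₁ Γ₂} {j i : ℕ} (h : i ∈ S.frontier j) :
    j ≤ S.arity := by
  by_contra hj
  rw [S.frontier_eq_empty j (by omega)] at h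
  simp at h

theorem exists_mark {S : UnitSlice Γ₁ Γ₂} {j i : ℕ} (h : i ∈ S.frontier j) :
    ∃ e d, S.Mark j e i d := by
  obtain ⟨e, he | he, -⟩ := S.existsUnique_edge j i h
  · exact ⟨e, _, Or.inl ⟨he, rfl⟩⟩
  · exact ⟨e, _, Or.inr ⟨he, rfl⟩⟩

/-- Directions are recorded relative to the tree. An edge goes upwards if its target is in the
out-frontier or its source is in an in-frontier, so the two orientations allowed by gluing are
exactly those with equal `d` on both sides. Since a frontier vertex has a unique edge, which cannot
have both ends in that frontier, its record is unambiguous. -/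
theorem canGlue_iff_marks {S S' : UnitSlice Γ₁ Γ₂} {j : ℕ} (hj : 1 ≤ j) :
    S.CanGlue S' j ↔ ∀ i d b, (∃ e, S.Mark 0 e i d ∧ S.edgeLabel e = b) ↔
      (∃ e, S'.Mark j e i d ∧ S'.edgeLabel e = b) := by
  have hj0 : (j == 0) = false := by simp; omega
  constructor
  · rintro ⟨hF, hE⟩ i d b
    constructor
    · rintro ⟨e, hM, rfl⟩
      have hi := mem_frontier_of_incident hM.incident
      obtain ⟨e', d', hM'⟩ := exists_mark ((hF i).1 hi)
      obtain ⟨hl, h⟩ := hE i hi e e' hM.incident hM'.incident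
      refine ⟨e', ?_, hl.symm⟩
      rcases h with ⟨h1, h2⟩ | ⟨h1, h2⟩
      · rcases hM with ⟨h, rfl⟩ | ⟨h, rfl⟩
        · exact absurd ⟨h, h1⟩ (S.not_same_frontier e 0 i i)
        · exact Or.inl ⟨h2, by simp [hj0]⟩
      · rcases hM with ⟨h, rfl⟩ | ⟨h, rfl⟩
        · exact Or.inr ⟨h2, by simp [hj0]⟩
        · exact absurd ⟨h1, h⟩ (S.not_same_frontier e 0 i i)
    · rintro ⟨e', hM, rfl⟩
      have hi := (hF i).2 (mem_frontier_of_incident hM.incident)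
      obtain ⟨e, d', hM'⟩ := exists_mark hi
      obtain ⟨hl, h⟩ := hE i hi e e' hM'.incident hM.incident
      refine ⟨e, ?_, hl⟩
      rcases h with ⟨h1, h2⟩ | ⟨h1, h2⟩
      · rcases hM with ⟨h, rfl⟩ | ⟨h, rfl⟩
        · exact Or.inr ⟨h1, by simp [hj0]⟩
        · exact absurd ⟨h2, h⟩ (S'.not_same_frontier e' j i i)
      · rcases hM with ⟨h, rfl⟩ | ⟨h, rfl⟩
        · exact absurd ⟨h, h2⟩ (S'.not_same_frontier e' j i i)
        · exact Or.inl ⟨h1, by simp [hj0]⟩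
  · intro H
    refine ⟨fun i => ⟨fun hi => ?_, fun hi => ?_⟩, fun i hi e e' he he' => ?_⟩
    · obtain ⟨e, d, hM⟩ := exists_mark hi
      obtain ⟨e', hM', -⟩ := (H i d _).1 ⟨e, hM, rfl⟩
      exact mem_frontier_of_incident hM'.incident
    · obtain ⟨e, d, hM⟩ := exists_mark hi
      obtain ⟨e', hM', -⟩ := (H i d _).2 ⟨e, hM, rfl⟩
      exact mem_frontier_of_incident hM'.incident
    · rcases he with he | he
      · obtain ⟨e'', hM, hl⟩ := (H i 0 _).1 ⟨e, Or.inl ⟨he, rfl⟩, rfl⟩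
        obtain rfl := eq_of_incident hM.incident he'
        refine ⟨hl.symm, Or.inr ⟨he, ?_⟩⟩
        rcases hM with ⟨-, h⟩ | ⟨h, -⟩
        · simp [hj0] at h
        · exact h
      · obtain ⟨e'', hM, hl⟩ := (H i 1 _).1 ⟨e, Or.inr ⟨he, rfl⟩, rfl⟩
        obtain rfl := eq_of_incident hM.incident he'
        refine ⟨hl.symm, Or.inl ⟨he, ?_⟩⟩
        rcases hM with ⟨h, -⟩ | ⟨-, h⟩
        · exact h
        · simp [hj0] at h

theorem canGlue_iff_tile [Encodable Γ₁] [Encodable Γ₂] {S S' : UnitSlice Γ₁ Γ₂} {j : ℕ}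
    (hj : 1 ≤ j) :
    S.CanGlue S' j ↔ tile S.code (fullMask S.code) 0 = tile S'.code (fullMask S'.code) j := by
  simp only [tile_eq_tile, testBit_fullMask, true_and, canGlue_iff_marks hj]

/-- Every frontier vertex leaves a record. With the shift by one in `tileStep`, the condition on the
root slice becomes the state 1. -/
theorem tile_code_eq_zero [Encodable Γ₁] [Encodable Γ₂] {S : UnitSlice Γ₁ Γ₂} {j : ℕ} :
    tile S.code (fullMask S.code) j = 0 ↔ S.frontier j = ∅ := by
  obtain ⟨l, hl, hm⟩ := tile_code S (fullMask S.code) j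
  rw [hl]
  have : maskOf l = 0 ↔ ∀ a, a ∉ l := by
    rw [show (0 : ℕ) = maskOf [] from rfl, maskOf_eq_maskOf]
    simp
  rw [this, Finset.eq_empty_iff_forall_notMem]
  constructor
  · intro h i hi
    obtain ⟨e, d, hM⟩ := exists_mark hi
    exact h _ ((hm _).2 ⟨e, i, d, testBit_fullMask S e, hM, rfl⟩)
  · intro h a ha
    obtain ⟨e, i, d, -, hM, -⟩ := (hm a).1 ha
    exact h i (mem_frontier_of_incident hM.incident)

/-- Only edges that meet a frontier leave records, and a record consists of a number at most `c`, a
direction and a label. Loops at the center do not contribute, which keeps the state set finite over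
a possibly infinite alphabet. -/
theorem tile_code_lt [Encodable Γ₁] [Encodable Γ₂] {S : UnitSlice Γ₁ Γ₂} {B c : ℕ}
    (hB : ∀ b : Γ₂, Encodable.encode b < B) (hS : S.extraWidth ≤ c) (m j : ℕ) :
    tile S.code m j + 1 < tileBound B c := by
  obtain ⟨l, hl, hm⟩ := tile_code S m j
  rw [hl, tileBound]
  apply Nat.add_lt_add_right
  apply maskOf_lt
  intro a ha
  obtain ⟨e, i, d, -, hM, rfl⟩ := (hm a).1 ha
  have hi := mem_frontier_of_incident hM.incident
  have hic : i ≤ c := by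
    refine le_trans ?_ hS
    have h1 : i ≤ (S.frontier j).sup id := Finset.le_sup (f := id) hi
    exact h1.trans (Finset.le_sup (f := fun j => (S.frontier j).sup id)
      (Finset.mem_range.2 (Nat.lt_succ_of_le (le_arity_of_mem_frontier hi))))
  have hd : d < 2 := by
    rcases hM with ⟨-, rfl⟩ | ⟨-, rfl⟩ <;> cases j == 0 <;> simp
  have hb := hB (S.edgeLabel e)
  rw [markBound, add_comm B 2]
  exact pair_lt_add_sq (by omega) (pair_lt_add_sq hd hb)

end UnitSlice

/-! ### Edge parts of unit decompositions -/

namespace Term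

variable {F : Type u} {ar : F → ℕ}

theorem subterm?_append (t : Term ar) (p q : List ℕ) :
    t.subterm? (p ++ q) = (t.subterm? p).bind fun s => s.subterm? q := by
  induction p generalizing t with
  | nil => cases t; rfl
  | cons j p ih =>
    cases t with
    | node f ts =>
      simp only [List.cons_append, subterm?]
      split_ifs
      · exact ih _
      · rfl

theorem symbol?_append_singleton {t : Term ar} {p : List ℕ} {j : ℕ} :
    (t.symbol? (p ++ [j])).isSome ↔ ∃ f, t.symbol? p = some f ∧ 1 ≤ j ∧ j ≤ ar f := by
  simp only [symbol?, subterm?_append]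
  cases t.subterm? p with
  | none => simp
  | some s =>
    cases s with
    | node f ts =>
      simp only [Option.bind_some, subterm?, Option.map_some, Option.some.injEq, leading]
      by_cases h : 1 ≤ j ∧ j ≤ ar f
      · rw [dif_pos h]
        cases hs : ts ⟨j - 1, by omega⟩
        simp [h]
      · simp [h]

end Term

namespace SliceTerm

variable {Γ₁ : Type u} {Γ₂ : Type v} {Sig : Set (UnitSlice Γ₁ Γ₂)} {T : SliceTerm Sig}

theorem exists_child {p : T.Pos} {j : ℕ} (h : 1 ≤ j) (h' : j ≤ (slice T p).arity) :
    ∃ p' : T.Pos, p'.1 = p.1 ++ [j] := by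
  have := Term.symbol?_append_singleton.2 ⟨_, Term.symbol?_pos T p, h, h'⟩
  obtain ⟨f, hf⟩ := Option.isSome_iff_exists.1 this
  obtain ⟨p', hp', -⟩ := Term.exists_pos_of_symbol? hf
  exact ⟨p', hp'⟩

theorem exists_parent {p' : T.Pos} (h : p'.1 ≠ []) :
    ∃ (p : T.Pos) (j : ℕ), p'.1 = p.1 ++ [j] := by
  obtain ⟨q, j, hq⟩ : ∃ q j, p'.1 = q ++ [j] :=
    ⟨_, _, (List.dropLast_append_getLast h).symm⟩
  have := Term.symbol?_pos T p'
  rw [hq] at this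
  obtain ⟨f, hf, -⟩ := Term.symbol?_append_singleton.1 (Option.isSome_iff_exists.2 ⟨_, this⟩)
  obtain ⟨p, rfl, -⟩ := Term.exists_pos_of_symbol? hf
  exact ⟨p, j, hq⟩

theorem one_le_of_child {p p' : T.Pos} {j : ℕ} (h : p'.1 = p.1 ++ [j]) : 1 ≤ j := by
  have := Term.symbol?_pos T p'
  rw [h] at this
  obtain ⟨f, -, hj, -⟩ := Term.symbol?_append_singleton.1 (Option.isSome_iff_exists.2 ⟨_, this⟩)
  exact hj

theorem slice_root {p : T.Pos} (h : p.1 = []) : slice T p = T.leading.1 := by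
  have := Term.symbol?_pos T p
  rw [h, Term.symbol?_nil] at this
  exact congrArg Subtype.val (Option.some.inj this).symm

namespace EdgePart

/-- Two parts in the same slice with a common frontier vertex are equal. -/
theorem eq_of_incident {x y : EdgePart T} {j k : ℕ} (hp : x.pos.1 = y.pos.1)
    (hx : x.source = .frontier j k ∨ x.target = .frontier j k)
    (hy : y.source = .frontier j k ∨ y.target = .frontier j k) : x = y := by
  rcases x with ⟨p, e⟩
  rcases y with ⟨p', e'⟩
  obtain rfl : p = p' := Subtype.ext hp
  obtain rfl : e = e' := UnitSlice.eq_of_incident hx hy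
  rfl

theorem not_same_frontier (x : EdgePart T) {j k k' : ℕ} (h : x.source = .frontier j k) :
    x.target ≠ .frontier j k' := fun h' =>
  (slice T x.pos).not_same_frontier x.edge j k k' ⟨h, h'⟩

end EdgePart

open EdgePart

variable {p p' : T.Pos} {j : ℕ}

theorem marks_iff (hT : IsUnitPreDecomposition T) (h : p'.1 = p.1 ++ [j]) (i d : ℕ) (b : Γ₂) :
    (∃ e, (slice T p').Mark 0 e i d ∧ (slice T p').edgeLabel e = b) ↔
      (∃ e, (slice T p).Mark j e i d ∧ (slice T p).edgeLabel e = b) :=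
  (UnitSlice.canGlue_iff_marks (one_le_of_child h)).1 (hT p p' j h) i d b

theorem mark_zero {S : UnitSlice Γ₁ Γ₂} {e : Fin S.numEdges} {i : ℕ} :
    (S.Mark 0 e i 0 ↔ S.source e = .frontier 0 i) ∧
      (S.Mark 0 e i 1 ↔ S.target e = .frontier 0 i) := by
  simp [UnitSlice.Mark]

theorem mark_pos {S : UnitSlice Γ₁ Γ₂} {e : Fin S.numEdges} {i : ℕ} (hj : 1 ≤ j) :
    (S.Mark j e i 0 ↔ S.target e = .frontier j i) ∧
      (S.Mark j e i 1 ↔ S.source e = .frontier j i) := by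
  have hj0 : (j == 0) = false := by simp; omega
  simp [UnitSlice.Mark, hj0]

/-- This lemma and the next three cross a glued frontier, upwards or downwards, with or against the
direction of the edge. -/
theorem exists_parent_source (hT : IsUnitPreDecomposition T) {x : EdgePart T} {k : ℕ}
    (h : x.pos.1 = p.1 ++ [j]) (hx : x.target = .frontier 0 k) :
    ∃ y : EdgePart T, y.pos = p ∧ y.source = .frontier j k ∧ y.label = x.label := by
  obtain ⟨e, he, hl⟩ := (marks_iff hT h k 1 x.label).1 ⟨x.edge, mark_zero.2.2 hx, rfl⟩
  exact ⟨⟨p, e⟩, rfl, (mark_pos (one_le_of_child h)).2.1 he, hl⟩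

theorem exists_parent_target (hT : IsUnitPreDecomposition T) {x : EdgePart T} {k : ℕ}
    (h : x.pos.1 = p.1 ++ [j]) (hx : x.source = .frontier 0 k) :
    ∃ y : EdgePart T, y.pos = p ∧ y.target = .frontier j k ∧ y.label = x.label := by
  obtain ⟨e, he, hl⟩ := (marks_iff hT h k 0 x.label).1 ⟨x.edge, mark_zero.1.2 hx, rfl⟩
  exact ⟨⟨p, e⟩, rfl, (mark_pos (one_le_of_child h)).1.1 he, hl⟩

theorem exists_child_target (hT : IsUnitPreDecomposition T) {x : EdgePart T} {k : ℕ}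
    (h : p'.1 = x.pos.1 ++ [j]) (hx : x.source = .frontier j k) :
    ∃ y : EdgePart T, y.pos = p' ∧ y.target = .frontier 0 k ∧ y.label = x.label := by
  obtain ⟨e, he, hl⟩ := (marks_iff hT h k 1 x.label).2
    ⟨x.edge, (mark_pos (one_le_of_child h)).2.2 hx, rfl⟩
  exact ⟨⟨p', e⟩, rfl, mark_zero.2.1 he, hl⟩

theorem exists_child_source (hT : IsUnitPreDecomposition T) {x : EdgePart T} {k : ℕ}
    (h : p'.1 = x.pos.1 ++ [j]) (hx : x.target = .frontier j k) :
    ∃ y : EdgePart T, y.pos = p' ∧ y.source = .frontier 0 k ∧ y.label = x.label := by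
  obtain ⟨e, he, hl⟩ := (marks_iff hT h k 0 x.label).2
    ⟨x.edge, (mark_pos (one_le_of_child h)).1.2 hx, rfl⟩
  exact ⟨⟨p', e⟩, rfl, mark_zero.1.1 he, hl⟩

theorem pos_ne_nil (hT : IsUnitDecomposition T) {x : EdgePart T} {k : ℕ}
    (hx : x.source = .frontier 0 k ∨ x.target = .frontier 0 k) : x.pos.1 ≠ [] := by
  intro h
  have := UnitSlice.mem_frontier_of_incident (S := slice T x.pos) hx
  rw [slice_root h, hT.2] at this
  simp at this

theorem exists_child_of_incident {x : EdgePart T} {k : ℕ} (hj : 1 ≤ j)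
    (hx : x.source = .frontier j k ∨ x.target = .frontier j k) :
    ∃ p' : T.Pos, p'.1 = x.pos.1 ++ [j] :=
  exists_child hj (UnitSlice.le_arity_of_mem_frontier
    (UnitSlice.mem_frontier_of_incident (S := slice T x.pos) hx))

/-- A part ending in the out-frontier has a parent slice to enter, because the out-frontier of the
root is empty. A part ending in an in-frontier has a child slice to enter, because frontiers beyond
the arity are empty. Gluing provides the next part. -/
theorem exists_continues (hT : IsUnitDecomposition T) {x : EdgePart T} (hx : x.target ≠ .center) :
    ∃ y, Continues x y := by
  cases h : x.target with
  | center => exact absurd h hx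
  | frontier j k =>
    rcases Nat.eq_zero_or_pos j with rfl | hj
    · obtain ⟨p, j, hp⟩ := exists_parent (pos_ne_nil hT (Or.inr h))
      obtain ⟨y, rfl, hy, -⟩ := exists_parent_source hT.1 hp h
      exact ⟨y, j, k, Or.inl ⟨hp, h, hy⟩⟩
    · obtain ⟨p', hp'⟩ := exists_child_of_incident hj (Or.inr h)
      obtain ⟨y, rfl, hy, -⟩ := exists_child_source hT.1 hp' h
      exact ⟨y, j, k, Or.inr ⟨hp', h, hy⟩⟩

theorem exists_continues_left (hT : IsUnitDecomposition T) {y : EdgePart T}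
    (hy : y.source ≠ .center) : ∃ x, Continues x y := by
  cases h : y.source with
  | center => exact absurd h hy
  | frontier j k =>
    rcases Nat.eq_zero_or_pos j with rfl | hj
    · obtain ⟨p, j, hp⟩ := exists_parent (pos_ne_nil hT (Or.inl h))
      obtain ⟨x, rfl, hx, -⟩ := exists_parent_target hT.1 hp h
      exact ⟨x, j, k, Or.inr ⟨hp, hx, h⟩⟩
    · obtain ⟨p', hp'⟩ := exists_child_of_incident hj (Or.inl h)
      obtain ⟨x, rfl, hx, -⟩ := exists_child_target hT.1 hp' h
      exact ⟨x, j, k, Or.inl ⟨hp', hx, h⟩⟩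

/-- The frontier vertex where `x` ends determines the neighbouring slice and the vertex in it, and
that vertex has only one edge. The mixed cases are impossible because child indices are positive
while the out-frontier has index 0. -/
theorem continues_right_unique {x y y' : EdgePart T} (h : Continues x y) (h' : Continues x y') :
    y = y' := by
  obtain ⟨j, k, ⟨hp, ht, hs⟩ | ⟨hp, ht, hs⟩⟩ := h <;>
    obtain ⟨j', k', ⟨hp', ht', hs'⟩ | ⟨hp', ht', hs'⟩⟩ := h'
  · rw [ht, SliceVertex.frontier.injEq] at ht'
    rw [hp] at hp'
    obtain ⟨h1, h2⟩ := List.append_inj' hp' rfl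
    obtain rfl : j = j' := by simpa using h2
    obtain rfl := ht'.2
    exact eq_of_incident h1 (Or.inl hs) (Or.inl hs')
  · rw [ht, SliceVertex.frontier.injEq] at ht'
    have := one_le_of_child hp'
    omega
  · rw [ht, SliceVertex.frontier.injEq] at ht'
    have := one_le_of_child hp
    omega
  · rw [ht, SliceVertex.frontier.injEq] at ht'
    obtain ⟨rfl, rfl⟩ := ht'
    exact eq_of_incident (hp.trans hp'.symm) (Or.inl hs) (Or.inl hs')

theorem continues_left_unique {x x' y : EdgePart T} (h : Continues x y) (h' : Continues x' y) :
    x = x' := by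
  obtain ⟨j, k, ⟨hp, ht, hs⟩ | ⟨hp, ht, hs⟩⟩ := h <;>
    obtain ⟨j', k', ⟨hp', ht', hs'⟩ | ⟨hp', ht', hs'⟩⟩ := h'
  · rw [hs, SliceVertex.frontier.injEq] at hs'
    obtain ⟨rfl, rfl⟩ := hs'
    exact eq_of_incident (hp.trans hp'.symm) (Or.inr ht) (Or.inr ht')
  · rw [hs, SliceVertex.frontier.injEq] at hs'
    have := one_le_of_child hp
    omega
  · rw [hs, SliceVertex.frontier.injEq] at hs'
    have := one_le_of_child hp'
    omega
  · rw [hs, SliceVertex.frontier.injEq] at hs'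
    rw [hp] at hp'
    obtain ⟨h1, h2⟩ := List.append_inj' hp' rfl
    obtain rfl : j = j' := by simpa using h2
    obtain rfl := hs'.2
    exact eq_of_incident h1 (Or.inr ht) (Or.inr ht')

theorem not_continues_of_target {x y : EdgePart T} (hx : x.target = .center) :
    ¬ Continues x y := by
  rintro ⟨j, k, ⟨-, h, -⟩ | ⟨-, h, -⟩⟩ <;> simp [hx] at h

theorem not_continues_of_source {x y : EdgePart T} (hy : y.source = .center) :
    ¬ Continues x y := by
  rintro ⟨j, k, ⟨-, -, h⟩ | ⟨-, -, h⟩⟩ <;> simp [hy] at h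

/-! ### Sliced sequences partition the parts of a unit decomposition -/

/-- Sliced sequences first go up and then down: some bounded quantity decreases along them. -/
theorem exists_rank (T : SliceTerm Sig) : ∃ (N : ℕ) (μ : EdgePart T → ℕ),
    (∀ x, μ x ≤ N) ∧ ∀ x y, Continues x y → μ y < μ x := by
  classical
  obtain ⟨H, hH⟩ := Term.exists_length_bound T
  have hH' : ∀ p : T.Pos, p.1.length ≤ H := fun p => hH _ _ (Term.symbol?_pos T p)
  -- `H` bounds the depth. A part that entered from its parent cannot leave through the same
  -- frontier, so from then on the sequence descends and `H - depth` decreases. Before that it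
  -- ascends and `H + 1 + depth` decreases; the summand `H + 1` places all values of this phase
  -- above those of the descent.
  refine ⟨H + 1 + H, fun x => if ∃ k, x.source = .frontier 0 k then H - x.pos.1.length
    else H + 1 + x.pos.1.length, fun x => ?_, fun x y h => ?_⟩
  · have := hH' x.pos
    dsimp only
    split_ifs <;> omega
  · have hx' := hH' x.pos
    have hy' := hH' y.pos
    dsimp only
    obtain ⟨j, k, ⟨hp, ht, hs⟩ | ⟨hp, ht, hs⟩⟩ := h
    · have hj := one_le_of_child hp
      have hx : ¬ ∃ k, x.source = .frontier 0 k := fun ⟨k', hk'⟩ => x.not_same_frontier hk' ht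
      have hy : ¬ ∃ k, y.source = .frontier 0 k := by
        rintro ⟨k', hk'⟩
        rw [hs, SliceVertex.frontier.injEq] at hk'
        omega
      rw [if_neg hx, if_neg hy, hp]
      simp
    · rw [if_pos (⟨k, hs⟩ : ∃ k, y.source = .frontier 0 k)]
      rw [hp, List.length_append, List.length_singleton] at hy' ⊢
      split_ifs <;> omega

/-- Sets of parts that are unions of sliced sequences. -/
def IsClosedSet (C : Set (EdgePart T)) : Prop := ∀ x y, Continues x y → (x ∈ C ↔ y ∈ C)

theorem IsClosedSet.mem_iff {C : Set (EdgePart T)} (hC : IsClosedSet C) {l : List (EdgePart T)}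
    (hl : l.IsChain Continues) {x y : EdgePart T} (hx : x ∈ l) (hy : y ∈ l) : x ∈ C ↔ y ∈ C := by
  have key : ∀ (a : EdgePart T) (l : List (EdgePart T)), (a :: l).IsChain Continues →
      ∀ z ∈ a :: l, (z ∈ C ↔ a ∈ C) := by
    intro a l
    induction l generalizing a with
    | nil => intro _ z hz; rw [List.mem_singleton.1 hz]
    | cons b l ih =>
      intro h z hz
      rw [List.isChain_cons_cons] at h
      rcases List.mem_cons.1 hz with rfl | hz
      · rfl
      · rw [ih b h.2 z hz, hC a b h.1]
  cases l with
  | nil => simp at hx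
  | cons a l => rw [key a l hl x hx, key a l hl y hy]

theorem exists_forward (hT : IsUnitDecomposition T) (x : EdgePart T) :
    ∃ l : List (EdgePart T), (x :: l).IsChain Continues ∧
      ((x :: l).getLast (by simp)).target = .center := by
  obtain ⟨N, μ, -, hμ⟩ := exists_rank T
  induction h : μ x using Nat.strong_induction_on generalizing x with
  | _ n ih =>
    subst h
    by_cases hx : x.target = .center
    · exact ⟨[], by simp, hx⟩
    · obtain ⟨y, hy⟩ := exists_continues hT hx
      obtain ⟨l, hl, hlast⟩ := ih _ (hμ x y hy) y rfl
      exact ⟨y :: l, List.isChain_cons_cons.2 ⟨hy, hl⟩, by simpa using hlast⟩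

/-- After extending `x` forwards to a center by `exists_forward`, the sequence is extended
backwards. The rank increases at each backward step and is bounded by `N`, so this stops, and it can
only stop at a part starting in a center. -/
theorem exists_sequence (hT : IsUnitDecomposition T) (x : EdgePart T) :
    ∃ K : SlicedEdgeSequence T, x ∈ K.parts := by
  obtain ⟨N, μ, hN, hμ⟩ := exists_rank T
  have key : ∀ (n : ℕ) (x : EdgePart T) (l : List (EdgePart T)), N - μ x = n →
      (x :: l).IsChain Continues → ((x :: l).getLast (by simp)).target = .center →
      ∃ K : SlicedEdgeSequence T, x :: l ⊆ K.parts := by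
    intro n
    induction n using Nat.strong_induction_on with
    | _ n ih =>
      intro x l hn hl hlast
      by_cases hx : x.source = .center
      · exact ⟨⟨x :: l, by simp, hl, hx, hlast⟩, fun _ h => h⟩
      · obtain ⟨w, hw⟩ := exists_continues_left hT hx
        have h1 := hμ w x hw
        have h2 := hN w
        have hc : (w :: x :: l).IsChain Continues := List.isChain_cons_cons.2 ⟨hw, hl⟩
        obtain ⟨K, hK⟩ := ih (N - μ w) (by omega) w (x :: l) rfl hc (by simpa using hlast)
        exact ⟨K, fun z hz => hK (List.mem_cons_of_mem _ hz)⟩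
  obtain ⟨l, hl, hlast⟩ := exists_forward hT x
  obtain ⟨K, hK⟩ := key _ x l rfl hl hlast
  exact ⟨K, hK (by simp)⟩

theorem chain_succ {α : Type*} {R : α → α → Prop} {l : List α} (hl : l.IsChain R) (h : l ≠ [])
    {x : α} (hx : x ∈ l) : x = l.getLast h ∨ ∃ y ∈ l, R x y := by
  induction l with
  | nil => simp at hx
  | cons a l ih =>
    cases l with
    | nil => left; simpa using hx
    | cons b l =>
      rw [List.isChain_cons_cons] at hl
      rcases List.mem_cons.1 hx with rfl | hx
      · exact Or.inr ⟨b, by simp, hl.1⟩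
      · rcases ih hl.2 (by simp) hx with h | ⟨y, hy, h⟩
        · left; simpa using h
        · exact Or.inr ⟨y, List.mem_cons_of_mem _ hy, h⟩

theorem chain_pred {α : Type*} {R : α → α → Prop} {l : List α} (hl : l.IsChain R) (h : l ≠ [])
    {x : α} (hx : x ∈ l) : x = l.head h ∨ ∃ y ∈ l, R y x := by
  induction l with
  | nil => simp at hx
  | cons a l ih =>
    rcases List.mem_cons.1 hx with rfl | hx
    · left; rfl
    · cases l with
      | nil => simp at hx
      | cons b l =>
        rw [List.isChain_cons_cons] at hl
        rcases ih hl.2 (by simp) hx with rfl | ⟨y, hy, h⟩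
        · exact Or.inr ⟨a, by simp, hl.1⟩
        · exact Or.inr ⟨y, List.mem_cons_of_mem _ hy, h⟩

theorem eq_head {K : SlicedEdgeSequence T} {x : EdgePart T} (hx : x ∈ K.parts)
    (h : x.source = .center) : x = K.parts.head K.ne_nil := by
  rcases chain_pred K.chain K.ne_nil hx with h' | ⟨y, -, h'⟩
  · exact h'
  · exact absurd h' (not_continues_of_source h)

theorem eq_getLast {K : SlicedEdgeSequence T} {x : EdgePart T} (hx : x ∈ K.parts)
    (h : x.target = .center) : x = K.parts.getLast K.ne_nil := by
  rcases chain_succ K.chain K.ne_nil hx with h' | ⟨y, -, h'⟩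
  · exact h'
  · exact absurd h' (not_continues_of_target h)

/-- Inside the list, a neighbour of a part is its only neighbour in `T`. The two ends of the list
meet centers and have no neighbours outside. -/
theorem isClosedSet_parts (K : SlicedEdgeSequence T) : IsClosedSet {x | x ∈ K.parts} := by
  intro x y hxy
  constructor
  · intro hx
    rcases chain_succ K.chain K.ne_nil hx with rfl | ⟨z, hz, h⟩
    · exact absurd hxy (not_continues_of_target K.target_eq)
    · exact continues_right_unique hxy h ▸ hz
  · intro hy
    rcases chain_pred K.chain K.ne_nil hy with rfl | ⟨z, hz, h⟩
    · exact absurd hxy (not_continues_of_source K.source_eq)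
    · exact continues_left_unique hxy h ▸ hz

/-- Successors are unique, and a part ending in a center has none, so neither list can stop before
the other. -/
theorem chain_unique {x : EdgePart T} {l l' : List (EdgePart T)} (hl : (x :: l).IsChain Continues)
    (hl' : (x :: l').IsChain Continues) (h : ((x :: l).getLast (by simp)).target = .center)
    (h' : ((x :: l').getLast (by simp)).target = .center) : l = l' := by
  induction l generalizing x l' with
  | nil =>
    cases l' with
    | nil => rfl
    | cons a l' => exact absurd (List.isChain_cons_cons.1 hl').1 (not_continues_of_target h)
  | cons a l ih =>
    rw [List.isChain_cons_cons] at hl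
    cases l' with
    | nil => exact absurd hl.1 (not_continues_of_target h')
    | cons b l' =>
      rw [List.isChain_cons_cons] at hl'
      obtain rfl := continues_right_unique hl.1 hl'.1
      rw [ih hl.2 hl'.2 (by simpa using h) (by simpa using h')]

theorem sequence_ext {K K' : SlicedEdgeSequence T} (h : K.parts = K'.parts) : K = K' := by
  cases K; cases K'; subst h; rfl

/-- Sliced sequences with a common part are equal. -/
theorem eq_of_mem_parts {K K' : SlicedEdgeSequence T} {x : EdgePart T} (hx : x ∈ K.parts)
    (hx' : x ∈ K'.parts) : K = K' := by
  have h1 : K.parts.head K.ne_nil ∈ K'.parts :=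
    ((isClosedSet_parts K').mem_iff K.chain hx (List.head_mem K.ne_nil)).1 hx'
  have h2 := eq_head h1 K.source_eq
  apply sequence_ext
  rcases K with ⟨l, hl, hc, hs, ht⟩
  rcases K' with ⟨l', hl', hc', hs', ht'⟩
  cases l with
  | nil => exact absurd rfl hl
  | cons a l =>
    cases l' with
    | nil => exact absurd rfl hl'
    | cons b l' =>
      obtain rfl : a = b := h2
      exact congrArg (a :: ·) (chain_unique hc hc' ht ht')

/-- The parts of a set of sliced sequences. -/
def partsOf (W : Set (SlicedEdgeSequence T)) : Set (EdgePart T) := {x | ∃ K ∈ W, x ∈ K.parts}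

theorem isClosedSet_partsOf (W : Set (SlicedEdgeSequence T)) : IsClosedSet (partsOf W) := by
  intro x y h
  refine exists_congr fun K => and_congr_right fun _ => isClosedSet_parts K x y h

/-- A closed set contains all parts of a sliced sequence or none, and every part belongs to some
sequence. This identifies closed sets with sets of edges. -/
theorem IsClosedSet.eq_partsOf {C : Set (EdgePart T)} (hT : IsUnitDecomposition T)
    (hC : IsClosedSet C) : C = partsOf {K | ∃ x ∈ K.parts, x ∈ C} := by
  ext x
  constructor
  · intro hx
    obtain ⟨K, hK⟩ := exists_sequence hT x
    exact ⟨K, ⟨x, hK, hx⟩, hK⟩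
  · rintro ⟨K, ⟨y, hy, hyC⟩, hx⟩
    exact (hC.mem_iff K.chain hy hx).1 hyC

theorem mem_partsOf_singleton {K : SlicedEdgeSequence T} {x : EdgePart T} :
    x ∈ partsOf {K} ↔ x ∈ K.parts := by
  simp [partsOf]

theorem existsUnique_start (K : SlicedEdgeSequence T) :
    ∃! x : EdgePart T, x ∈ partsOf {K} ∧ x.source = .center := by
  refine ⟨K.parts.head K.ne_nil, ⟨mem_partsOf_singleton.2 (List.head_mem _), K.source_eq⟩, ?_⟩
  rintro y ⟨hy, h⟩
  exact eq_head (mem_partsOf_singleton.1 hy) h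

/-- Every sequence inside `C` contributes its own first part, which starts in a center. A unique
such part therefore leaves room for only one sequence. -/
theorem IsClosedSet.exists_eq_singleton {C : Set (EdgePart T)} (hT : IsUnitDecomposition T)
    (hC : IsClosedSet C) (h : ∃! x : EdgePart T, x ∈ C ∧ x.source = .center) :
    ∃ K, C = partsOf {K} := by
  obtain ⟨x, ⟨hx, hs⟩, huniq⟩ := h
  obtain ⟨K, hK⟩ := exists_sequence hT x
  refine ⟨K, ?_⟩
  ext z
  rw [mem_partsOf_singleton]
  constructor
  · intro hz
    obtain ⟨K', hK'⟩ := exists_sequence hT z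
    have h1 : K'.parts.head K'.ne_nil ∈ C :=
      (hC.mem_iff K'.chain hK' (List.head_mem K'.ne_nil)).1 hz
    have h2 := huniq _ ⟨h1, K'.source_eq⟩
    have h3 : x ∈ K'.parts := h2 ▸ List.head_mem K'.ne_nil
    exact eq_of_mem_parts hK h3 ▸ hK'
  · intro hz
    exact (hC.mem_iff K.chain hK hz).1 hx

/-! ### Masks for sets of parts, and the local test for closedness -/

/-- The parts marked in a family of masks. -/
def markedParts (T : SliceTerm Sig) (m : List ℕ → ℕ) : Set (EdgePart T) :=
  {x | (m x.pos.1).testBit x.edge = true}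

/-- Every set of parts is marked by a family of masks. -/
theorem exists_markedParts (C : Set (EdgePart T)) : ∃ m : List ℕ → ℕ,
    (∀ p : T.Pos, m p.1 < 2 ^ (slice T p).numEdges) ∧ markedParts T m = C := by
  classical
  have h : ∀ p : List ℕ, ∃ n : ℕ, ∀ (p' : T.Pos), p'.1 = p → n < 2 ^ (slice T p').numEdges ∧
      ∀ e : Fin (slice T p').numEdges, n.testBit e = true ↔ (⟨p', e⟩ : EdgePart T) ∈ C := by
    intro p
    by_cases hp : ∃ p' : T.Pos, p'.1 = p
    · obtain ⟨p', rfl⟩ := hp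
      refine ⟨maskOf (((List.finRange (slice T p').numEdges).filter
        fun e => decide ((⟨p', e⟩ : EdgePart T) ∈ C)).map Fin.val), fun p'' h => ?_⟩
      obtain rfl : p'' = p' := Subtype.ext h
      refine ⟨maskOf_lt ?_, fun e => ?_⟩
      · intro i hi
        obtain ⟨e, -, rfl⟩ := List.mem_map.1 hi
        exact e.2
      · rw [testBit_maskOf]
        simp [Fin.val_inj]
    · exact ⟨0, fun p' h => absurd ⟨p', h⟩ hp⟩
  choose m hm using h
  refine ⟨m, fun p => (hm _ p rfl).1, ?_⟩
  ext x
  exact (hm _ x.pos rfl).2 x.edge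

theorem agree_iff {out : List ℕ → Sig → ℕ} {inn : List ℕ → Sig → ℕ → ℕ} :
    Term.Agree out inn T ↔ ∀ (p p' : T.Pos) (j : ℕ), p'.1 = p.1 ++ [j] →
      out p'.1 (T.symbolAt p') = inn p.1 (T.symbolAt p) j := by
  constructor
  · intro h p p' j hp
    have h1 := Term.symbol?_pos T p'
    rw [hp] at h1 ⊢
    exact h _ _ _ _ (Term.symbol?_pos T p) h1
  · intro h p j f g hf hg
    obtain ⟨p, rfl, rfl⟩ := Term.exists_pos_of_symbol? hf
    obtain ⟨p', hp', rfl⟩ := Term.exists_pos_of_symbol? hg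
    rw [← hp']
    exact h p p' j hp'

section Tile

variable [Encodable Γ₁] [Encodable Γ₂]

theorem agree_fullMask_iff : Term.Agree (fun _ (f : Sig) => tile f.1.code (fullMask f.1.code) 0)
    (fun _ (f : Sig) j => tile f.1.code (fullMask f.1.code) j) T ↔ IsUnitPreDecomposition T := by
  rw [agree_iff]
  refine forall₃_congr fun p p' j => forall_congr' fun h => ?_
  exact (UnitSlice.canGlue_iff_tile (one_le_of_child h)).symm

/-- Continuation relates the two parts meeting at a glued frontier vertex. Closedness says that both
or neither are marked, and this is what equality of the marked records on the two sides expresses.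
-/
theorem agree_iff_isClosedSet (hT : IsUnitPreDecomposition T) (m : List ℕ → ℕ) :
    Term.Agree (fun p (f : Sig) => tile f.1.code (m p) 0)
      (fun p (f : Sig) j => tile f.1.code (m p) j) T ↔ IsClosedSet (markedParts T m) := by
  rw [agree_iff]
  constructor
  · intro H x y h
    obtain ⟨j, k, ⟨hp, ht, hs⟩ | ⟨hp, ht, hs⟩⟩ := h
    · have h := UnitSlice.tile_eq_tile.1 (H _ _ j hp)
      have hj := one_le_of_child hp
      constructor
      · intro hx
        obtain ⟨e, he, hM, -⟩ := (h k 1 x.label).1 ⟨x.edge, hx, mark_zero.2.2 ht, rfl⟩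
        -- Only one part of the slice meets this frontier vertex, so the marked edge behind the
        -- record is `y`.
        rwa [eq_of_incident (x := y) (y := ⟨y.pos, e⟩) rfl (Or.inl hs)
          (Or.inl ((mark_pos hj).2.1 hM))]
      · intro hy
        obtain ⟨e, he, hM, -⟩ := (h k 1 y.label).2 ⟨y.edge, hy, (mark_pos hj).2.2 hs, rfl⟩
        rwa [eq_of_incident (x := x) (y := ⟨x.pos, e⟩) rfl (Or.inr ht)
          (Or.inr (mark_zero.2.1 hM))]
    · have h := UnitSlice.tile_eq_tile.1 (H _ _ j hp)
      have hj := one_le_of_child hp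
      constructor
      · intro hx
        obtain ⟨e, he, hM, -⟩ := (h k 0 x.label).2 ⟨x.edge, hx, (mark_pos hj).1.2 ht, rfl⟩
        rwa [eq_of_incident (x := y) (y := ⟨y.pos, e⟩) rfl (Or.inl hs)
          (Or.inl (mark_zero.1.1 hM))]
      · intro hy
        obtain ⟨e, he, hM, -⟩ := (h k 0 y.label).1 ⟨y.edge, hy, mark_zero.1.2 hs, rfl⟩
        rwa [eq_of_incident (x := x) (y := ⟨x.pos, e⟩) rfl (Or.inr ht)
          (Or.inr ((mark_pos hj).1.1 hM))]
  · intro H p p' j hp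
    have hj := one_le_of_child hp
    refine UnitSlice.tile_eq_tile.2 fun i d b => ⟨?_, ?_⟩
    · rintro ⟨e, he, hM, rfl⟩
      -- A record belongs to a marked part. Gluing supplies the part across the frontier with the
      -- same label, and closedness marks it.
      let x : EdgePart T := ⟨p', e⟩
      have hx : x ∈ markedParts T m := he
      rcases hM with ⟨hs, rfl⟩ | ⟨ht, rfl⟩
      · obtain ⟨y, rfl, hy, hl⟩ := exists_parent_target hT (x := x) hp hs
        exact ⟨y.edge, (H y x ⟨j, i, Or.inr ⟨hp, hy, hs⟩⟩).2 hx, (mark_pos hj).1.2 hy, hl⟩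
      · obtain ⟨y, rfl, hy, hl⟩ := exists_parent_source hT (x := x) hp ht
        exact ⟨y.edge, (H x y ⟨j, i, Or.inl ⟨hp, ht, hy⟩⟩).1 hx, (mark_pos hj).2.2 hy, hl⟩
    · rintro ⟨e, he, hM, rfl⟩
      have hj0 : (j == 0) = false := by simp; omega
      let x : EdgePart T := ⟨p, e⟩
      have hx : x ∈ markedParts T m := he
      rcases hM with ⟨hs, rfl⟩ | ⟨ht, rfl⟩
      · obtain ⟨y, rfl, hy, hl⟩ := exists_child_target hT (x := x) hp hs
        simp only [hj0, cond_false]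
        exact ⟨y.edge, (H y x ⟨j, i, Or.inl ⟨hp, hy, hs⟩⟩).2 hx, mark_zero.2.2 hy, hl⟩
      · obtain ⟨y, rfl, hy, hl⟩ := exists_child_source hT (x := x) hp ht
        simp only [hj0, cond_false]
        exact ⟨y.edge, (H x y ⟨j, i, Or.inr ⟨hp, ht, hy⟩⟩).1 hx, mark_zero.1.2 hy, hl⟩

end Tile

end SliceTerm

/-! ### Correctness of the automata -/

variable {Γ₁ : Type u} {Γ₂ : Type v}

theorem envGet_cons (σ : List (ℕ × ℕ)) (t x m t' x' : ℕ) :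
    envGet ((Nat.pair t x, m) :: σ) t' x' = if t' = t ∧ x' = x then m else envGet σ t' x' := by
  unfold envGet
  rw [List.lookup_cons]
  by_cases h : t' = t ∧ x' = x
  · obtain ⟨rfl, rfl⟩ := h
    simp
  · have : (Nat.pair t' x' == Nat.pair t x) = false := by
      simpa [Nat.pair_eq_pair] using h
    rw [this, if_neg h]

theorem length_eq_zero_or_one {n : ℕ} {P : ℕ → Bool} :
    (((List.range n).filter P).length = 0 ↔ ∀ i, ¬ (i < n ∧ P i = true)) ∧
      (((List.range n).filter P).length = 1 ↔ ∃! i, i < n ∧ P i = true) := by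
  have hn : ((List.range n).filter P).Nodup := List.nodup_range.filter _
  constructor
  · simp
  · rw [← List.toFinset_card_of_nodup hn, Finset.card_eq_one, Finset.singleton_iff_unique_mem]
    simp

namespace UnitSlice

theorem isSome_code {w : SliceVertex} : w.code.isSome = false ↔ w = .center := by
  cases w <;> simp [SliceVertex.code]

theorem code_eq_none {w : SliceVertex} : w.code = none ↔ w = .center := by
  cases w <;> simp [SliceVertex.code]

variable {S : UnitSlice Γ₁ Γ₂}

theorem code_edges : S.code.2.2.2 =
    List.ofFn fun e => ((S.source e).code, (S.target e).code, S.edgeLabel e) := rfl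

variable [Encodable Γ₁] [Encodable Γ₂]

/-- The objects counted by `countMarks`. -/
def Counted (t : ℕ) (S : UnitSlice Γ₁ Γ₂) (m i : ℕ) : Prop :=
  if t = 13 then i = 0 ∧ S.center.isSome ∧ m.testBit 0 = true
  else ∃ e : Fin S.numEdges, (e : ℕ) = i ∧ m.testBit e = true ∧ S.source e = .center

theorem countMarks_code (t : ℕ) (m : ℕ) :
    (countMarks t S.code m = 0 ↔ ∀ i, ¬ Counted t S m i) ∧
      (countMarks t S.code m = 1 ↔ ∃! i, Counted t S m i) := by
  unfold countMarks Counted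
  by_cases ht : t = 13
  · have hc : S.code.2.1 = S.center := rfl
    simp only [ht, beq_self_eq_true, cond_true, hc, if_true]
    by_cases h : S.center.isSome = true ∧ m.testBit 0 = true
    · simp [h]
    · have h' : (S.center.isSome && m.testBit 0) = false := by
        rw [← Bool.not_eq_true, Bool.and_eq_true]; exact h
      rw [h', cond_false]
      refine ⟨iff_of_true rfl fun i hi => h hi.2, iff_of_false (by simp) ?_⟩
      rintro ⟨i, hi, -⟩
      exact h hi.2
  · have ht' : (t == 13) = false := by simpa using ht
    simp only [ht', cond_false, ht, if_false]
    have key : ∀ i, (i < S.code.2.2.2.length ∧ (m.testBit i &&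
        (S.code.2.2.2[i]?.map fun e => !e.1.isSome) == some true) = true) ↔
        ∃ e : Fin S.numEdges, (e : ℕ) = i ∧ m.testBit e = true ∧ S.source e = .center := by
      intro i
      rw [code_edges, List.length_ofFn]
      constructor
      · rintro ⟨hi, h⟩
        refine ⟨⟨i, hi⟩, rfl, ?_⟩
        simpa [hi, code_eq_none] using h
      · rintro ⟨e, rfl, h1, h2⟩
        refine ⟨e.2, ?_⟩
        simp [h1, h2, SliceVertex.code]
    simp only [← key]
    exact length_eq_zero_or_one

theorem any_edges {P : ℕ → Bool} :
    ((List.range S.code.2.2.2.length).any P) = true ↔ ∃ e : Fin S.numEdges, P e = true := by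
  rw [code_edges, List.length_ofFn]
  simp [Fin.exists_iff]

theorem any_markedEdges {m : ℕ} {P : EdgeCode Γ₂ → Bool} :
    ((markedEdges S.code.2.2.2 m).any P) = true ↔ ∃ e : Fin S.numEdges, m.testBit e = true ∧
      P ((S.source e).code, (S.target e).code, S.edgeLabel e) = true := by
  rw [code_edges]
  simp only [List.any_eq_true, mem_markedEdges]
  constructor
  · rintro ⟨_, ⟨e, he, rfl⟩, h⟩
    exact ⟨e, he, h⟩
  · rintro ⟨e, he, h⟩
    exact ⟨_, ⟨e, he, rfl⟩, h⟩

/-! ### Meaning of the local conditions; the numbers 13 to 16 are quantifier tags and also name the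
sorts of variables in `σ` -/

variable {a b : ℕ} {σ : List (ℕ × ℕ)}

theorem localCheck_zero : localCheck 0 (Nat.pair a b) S.code σ = true ↔
    S.center.isSome ∧ (envGet σ 13 a).testBit 0 = true ∧ (envGet σ 15 b).testBit 0 = true := by
  simp [localCheck, and_assoc, show S.code.2.1 = S.center from rfl]

theorem localCheck_one : localCheck 1 (Nat.pair a b) S.code σ = true ↔
    ∃ e : Fin S.numEdges, (envGet σ 14 a).testBit e = true ∧ (envGet σ 16 b).testBit e = true := by
  simp only [← Bool.and_eq_true]
  rw [← any_edges (P := fun e => (envGet σ 14 a).testBit e && (envGet σ 16 b).testBit e)]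
  simp [localCheck]

theorem localCheck_two : localCheck 2 (Nat.pair a b) S.code σ = true ↔
    S.center.isSome ∧ (envGet σ 13 a).testBit 0 = true ∧ (envGet σ 13 b).testBit 0 = true := by
  simp [localCheck, and_assoc, show S.code.2.1 = S.center from rfl]

theorem localCheck_three : localCheck 3 (Nat.pair a b) S.code σ = true ↔
    ∃ e : Fin S.numEdges, (envGet σ 14 a).testBit e = true ∧ (envGet σ 14 b).testBit e = true := by
  simp only [← Bool.and_eq_true]
  rw [← any_edges (P := fun e => (envGet σ 14 a).testBit e && (envGet σ 14 b).testBit e)]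
  simp [localCheck]

theorem localCheck_four : localCheck 4 (Nat.pair a b) S.code σ = true ↔
    S.center.isSome ∧
      ¬ ((envGet σ 15 a).testBit 0 = true ↔ (envGet σ 15 b).testBit 0 = true) := by
  have h : ∀ x y : Bool, (x ^^ y) = true ↔ ¬ (x = true ↔ y = true) := by decide
  rw [← h]
  simp [localCheck, show S.code.2.1 = S.center from rfl]

theorem localCheck_five : localCheck 5 (Nat.pair a b) S.code σ = true ↔
    ∃ e : Fin S.numEdges,
      ¬ ((envGet σ 16 a).testBit e = true ↔ (envGet σ 16 b).testBit e = true) := by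
  have h : ∀ x y : Bool, (x ^^ y) = true ↔ ¬ (x = true ↔ y = true) := by decide
  simp only [← h]
  rw [← any_edges (P := fun e => (envGet σ 16 a).testBit e ^^ (envGet σ 16 b).testBit e)]
  simp [localCheck]

theorem localCheck_six : localCheck 6 (Nat.pair a b) S.code σ = true ↔
    S.center.isSome ∧ (envGet σ 13 b).testBit 0 = true ∧
      ∃ e : Fin S.numEdges, (envGet σ 14 a).testBit e = true ∧ S.source e = .center := by
  have := any_markedEdges (S := S) (m := envGet σ 14 a) (P := fun e => !e.1.isSome)
  simp only [Bool.not_eq_true', isSome_code] at this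
  rw [← this]
  simp [localCheck, and_assoc, show S.code.2.1 = S.center from rfl]

theorem localCheck_seven : localCheck 7 (Nat.pair a b) S.code σ = true ↔
    S.center.isSome ∧ (envGet σ 13 b).testBit 0 = true ∧
      ∃ e : Fin S.numEdges, (envGet σ 14 a).testBit e = true ∧ S.target e = .center := by
  have := any_markedEdges (S := S) (m := envGet σ 14 a) (P := fun e => !e.2.1.isSome)
  simp only [Bool.not_eq_true', isSome_code] at this
  rw [← this]
  simp [localCheck, and_assoc, show S.code.2.1 = S.center from rfl]

theorem localCheck_eight {l : Γ₁} :
    localCheck 8 (Nat.pair a (Encodable.encode l)) S.code σ = true ↔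
      S.center = some l ∧ (envGet σ 13 a).testBit 0 = true := by
  simp [localCheck, show S.code.2.1 = S.center from rfl, and_comm]

theorem localCheck_nine {l : Γ₂} :
    localCheck 9 (Nat.pair a (Encodable.encode l)) S.code σ = true ↔
      ∃ e : Fin S.numEdges, (envGet σ 14 a).testBit e = true ∧ S.source e = .center ∧
        S.edgeLabel e = l := by
  have := any_markedEdges (S := S) (m := envGet σ 14 a)
    (P := fun e => !e.1.isSome && Encodable.encode e.2.2 == Encodable.encode l)
  simp only [Bool.and_eq_true, Bool.not_eq_true', isSome_code, beq_iff_eq,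
    Encodable.encode_inj] at this
  rw [← this]
  simp [localCheck]

end UnitSlice

namespace SliceTerm

variable [Encodable Γ₁] [Encodable Γ₂] {Sig : Set (UnitSlice Γ₁ Γ₂)}

/-- The state which the automaton of the formula with code `k` reaches on `T`. -/
def stepRun (k : ℕ) (T : SliceTerm Sig) (σ : List ℕ → List (ℕ × ℕ)) : ℕ :=
  Term.run (fun p (f : Sig) qs => step k f.1.code (σ p) qs) T

/-- The state which the guard automaton reaches on `T`. -/
def guardRun (t : ℕ) (T : SliceTerm Sig) (m : List ℕ → ℕ) : ℕ :=
  Term.run (fun p (f : Sig) qs => guardStep t f.1.code (m p) qs) T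

variable {T : SliceTerm Sig}

/-- The guard is a product of the counting automaton and the comparison of marked interfaces. A
nonzero second component means that no comparison failed. -/
theorem guardRun_snd (t : ℕ) (m : List ℕ → ℕ) : (guardRun t T m).unpair.2 ≠ 0 ↔
    Term.Agree (fun p (f : Sig) => tile f.1.code (m p) 0)
      (fun p (f : Sig) j => tile f.1.code (m p) j) T := by
  classical
  have h : guardRun t T m = Nat.pair _ _ := Term.run_pair
    (fun p (f : Sig) qs => min 2 (countMarks t f.1.code (m p) + qs.sum))
    (fun p (f : Sig) qs => tileStep f.1.code (m p) qs) T
  rw [h, Nat.unpair_pair]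
  have h2 := Term.run_agree (fun p (f : Sig) => tile f.1.code (m p) 0)
      (fun p (f : Sig) j => tile f.1.code (m p) j) T
  unfold tileStep
  rw [h2]
  split_ifs with h <;> simp [h]

theorem guardRun_fst (t : ℕ) (m : List ℕ → ℕ) : (guardRun t T m).unpair.1 = 1 ↔
    ∃! x : List ℕ × ℕ,
      Term.Marked (fun p (f : Sig) i => UnitSlice.Counted t f.1 (m p) i) T x := by
  have h : guardRun t T m = Nat.pair _ _ := Term.run_pair
    (fun p (f : Sig) qs => min 2 (countMarks t f.1.code (m p) + qs.sum))
    (fun p (f : Sig) qs => tileStep f.1.code (m p) qs) T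
  rw [h, Nat.unpair_pair]
  exact (Term.run_count (fun p (f : Sig) => (UnitSlice.countMarks_code t (m p)).1)
    (fun p f => (UnitSlice.countMarks_code t (m p)).2) T).2

theorem guardRun_vertex (m : List ℕ → ℕ) : (guardRun 13 T m).unpair.1 = 1 ↔
    ∃! v : Support T, (m v.1.1).testBit 0 = true := by
  rw [guardRun_fst]
  constructor
  · rintro ⟨⟨p, i⟩, ⟨f, hf, hc⟩, huniq⟩
    obtain ⟨p, rfl, rfl⟩ := Term.exists_pos_of_symbol? hf
    simp only [UnitSlice.Counted, if_true] at hc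
    obtain ⟨rfl, hs, hb⟩ := hc
    refine ⟨⟨p, hs⟩, hb, fun v hv => ?_⟩
    have := huniq (v.1.1, 0) ⟨_, Term.symbol?_pos T v.1, by
      simp only [UnitSlice.Counted, if_true]; exact ⟨trivial, v.2, hv⟩⟩
    exact Subtype.ext (Subtype.ext (congrArg Prod.fst this))
  · rintro ⟨v, hv, huniq⟩
    refine ⟨(v.1.1, 0), ⟨_, Term.symbol?_pos T v.1, by
      simp only [UnitSlice.Counted, if_true]; exact ⟨trivial, v.2, hv⟩⟩, ?_⟩
    rintro ⟨p, i⟩ ⟨f, hf, hc⟩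
    obtain ⟨p, rfl, rfl⟩ := Term.exists_pos_of_symbol? hf
    simp only [UnitSlice.Counted, if_true] at hc
    obtain ⟨rfl, hs, hb⟩ := hc
    rw [← huniq ⟨p, hs⟩ hb]

/-- An edge has exactly one part that starts in a center, so counting such parts in a closed set
counts edges. -/
theorem guardRun_edge (m : List ℕ → ℕ) : (guardRun 14 T m).unpair.1 = 1 ↔
    ∃! x : EdgePart T, x ∈ markedParts T m ∧ x.source = .center := by
  rw [guardRun_fst]
  have h14 : ¬ (14 = 13) := by decide
  constructor
  · rintro ⟨⟨p, i⟩, ⟨f, hf, hc⟩, huniq⟩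
    obtain ⟨p, rfl, rfl⟩ := Term.exists_pos_of_symbol? hf
    simp only [UnitSlice.Counted, h14, if_false] at hc
    obtain ⟨e, rfl, hb, hs⟩ := hc
    refine ⟨⟨p, e⟩, ⟨hb, hs⟩, fun x hx => ?_⟩
    have := huniq (x.pos.1, x.edge) ⟨_, Term.symbol?_pos T x.pos, by
      simp only [UnitSlice.Counted, h14, if_false]; exact ⟨x.edge, rfl, hx.1, hx.2⟩⟩
    rcases x with ⟨p', e'⟩
    simp only [Prod.mk.injEq] at this
    obtain rfl : p' = p := Subtype.ext this.1
    obtain rfl : e' = e := Fin.ext this.2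
    rfl
  · rintro ⟨x, hx, huniq⟩
    refine ⟨(x.pos.1, x.edge), ⟨_, Term.symbol?_pos T x.pos, by
      simp only [UnitSlice.Counted, h14, if_false]; exact ⟨x.edge, rfl, hx.1, hx.2⟩⟩, ?_⟩
    rintro ⟨p, i⟩ ⟨f, hf, hc⟩
    obtain ⟨p, rfl, rfl⟩ := Term.exists_pos_of_symbol? hf
    simp only [UnitSlice.Counted, h14, if_false] at hc
    obtain ⟨e, rfl, hb, hs⟩ := hc
    rw [← huniq ⟨p, e⟩ ⟨hb, hs⟩]

theorem step_quantifier {t x k : ℕ} (ht : 13 ≤ t) (S : SliceCode Γ₁ Γ₂) (σ : List (ℕ × ℕ))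
    (qs : List ℕ) :
    step (Nat.pair t (Nat.pair x k)) S σ qs =
      maskOf ((choices S qs).map fun y =>
        Nat.pair (guardStep t S y.1 (y.2.map fun q => q.unpair.1))
          (step k S ((Nat.pair t x, y.1) :: σ) (y.2.map fun q => q.unpair.2))) := by
  rw [step]
  simp only [Nat.unpair_pair]
  rw [dif_neg (by omega), if_neg (by omega), if_neg (by omega)]

/-- The subset construction `testBit_run` guesses the masks. For each guess, `run_pair` separates
the run of the guard from that of the body, which sees the guess as the new value of the variable.
-/
theorem isFinal_stepRun_quantifier {t x k : ℕ} (ht : 13 ≤ t) (σ : List ℕ → List (ℕ × ℕ)) :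
    isFinal (Nat.pair t (Nat.pair x k)) (stepRun (Nat.pair t (Nat.pair x k)) T σ) = true ↔
      ∃ m : List ℕ → ℕ, (∀ p : T.Pos, m p.1 < 2 ^ ((slice T p).numEdges + 1)) ∧
        guardFinal t (guardRun t T m) = true ∧
        isFinal k (stepRun k T fun p => (Nat.pair t x, m p) :: σ p) = true := by
  have key := Term.testBit_run T (b := fun f : Sig => 2 ^ (f.1.numEdges + 1))
    (Δ := fun p (f : Sig) qs => step (Nat.pair t (Nat.pair x k)) f.1.code (σ p) qs)
    (δ := fun p (f : Sig) m qs =>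
      Nat.pair (guardStep t f.1.code m (qs.map fun q => q.unpair.1))
        (step k f.1.code ((Nat.pair t x, m) :: σ p) (qs.map fun q => q.unpair.2))) (by
      intro p f Qs q
      rw [step_quantifier ht, testBit_maskOf, decide_eq_true_iff]
      simp only [choices, List.mem_map, List.mem_flatMap, List.mem_range, List.mem_sections,
        UnitSlice.code_edges, List.length_ofFn]
      constructor
      · rintro ⟨_, ⟨m, hm, ps, hps, rfl⟩, rfl⟩
        refine ⟨m, hm, ps, ?_, rfl⟩
        rw [List.forall₂_map_right_iff] at hps
        exact hps.imp fun _ _ h => mem_bitsOf.1 h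
      · rintro ⟨m, hm, ps, hps, rfl⟩
        refine ⟨(m, ps), ⟨m, hm, ps, ?_, rfl⟩, rfl⟩
        rw [List.forall₂_map_right_iff]
        exact hps.imp fun _ _ h => mem_bitsOf.2 h)
  have hfin : ∀ q, isFinal (Nat.pair t (Nat.pair x k)) q = true ↔ ∃ q', q.testBit q' = true ∧
      guardFinal t q'.unpair.1 = true ∧ isFinal k q'.unpair.2 = true := by
    intro q
    rw [isFinal]
    simp only [Nat.unpair_pair]
    rw [dif_neg (by omega), if_neg (by omega), if_neg (by omega), if_neg (by omega)]
    simp [mem_bitsOf]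
  rw [hfin]
  have hb : ∀ m : List ℕ → ℕ, (∀ p f, T.symbol? p = some f → m p < 2 ^ (f.1.numEdges + 1)) ↔
      ∀ p : T.Pos, m p.1 < 2 ^ ((slice T p).numEdges + 1) := by
    intro m
    constructor
    · exact fun h p => h _ _ (Term.symbol?_pos T p)
    · intro h p f hf
      obtain ⟨p, rfl, rfl⟩ := Term.exists_pos_of_symbol? hf
      exact h p
  constructor
  · rintro ⟨q', hq', h1, h2⟩
    obtain ⟨m, hm, hrun⟩ := (key q').1 hq'
    rw [Term.run_pair (fun p (f : Sig) qs => guardStep t f.1.code (m p) qs)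
      (fun p (f : Sig) qs => step k f.1.code ((Nat.pair t x, m p) :: σ p) qs)] at hrun
    rw [← hrun, Nat.unpair_pair] at h1 h2
    exact ⟨m, (hb m).1 hm, h1, h2⟩
  · rintro ⟨m, hm, h1, h2⟩
    refine ⟨Nat.pair (guardRun t T m) (stepRun k T fun p => (Nat.pair t x, m p) :: σ p),
      (key _).2 ⟨m, (hb m).2 hm, ?_⟩, by rwa [Nat.unpair_pair], by rwa [Nat.unpair_pair]⟩
    exact Term.run_pair (fun p (f : Sig) qs => guardStep t f.1.code (m p) qs)
      (fun p (f : Sig) qs => step k f.1.code ((Nat.pair t x, m p) :: σ p) qs) T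

theorem stepRun_atom {t r : ℕ} (ht : t < 10) (σ : List ℕ → List (ℕ × ℕ)) :
    (stepRun (Nat.pair t r) T σ = 1 ↔
      ∃ p : T.Pos, localCheck t r (slice T p).code (σ p.1) = true) ∧
    (stepRun (Nat.pair t r) T σ = 0 ↔
      ¬ ∃ p : T.Pos, localCheck t r (slice T p).code (σ p.1) = true) := by
  have h : stepRun (Nat.pair t r) T σ = Term.run (fun p (f : Sig) qs =>
      bif localCheck t r f.1.code (σ p) || qs.any (fun q => q == 1) then 1 else 0) T := by
    refine Term.run_congr fun p f _ qs => ?_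
    rw [step]
    simp only [Nat.unpair_pair]
    rw [dif_pos ht]
  have h1 := Term.run_exists_eq_one (fun p (f : Sig) => localCheck t r f.1.code (σ p)) T
  have h2 := Term.run_exists (fun p (f : Sig) => localCheck t r f.1.code (σ p)) T
  rw [Term.exists_symbol?_iff (P := fun p (f : Sig) =>
    localCheck t r f.1.code (σ p) = true), ← h] at h1
  rw [← h] at h2
  refine ⟨h1, Iff.trans ?_ (not_congr h1)⟩
  rw [h2]
  cases (stepRun (Nat.pair t r) T σ == 1) <;> simp

theorem isFinal_stepRun_atom {t r : ℕ} (ht : t < 10) (h4 : t ≠ 4) (h5 : t ≠ 5)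
    (σ : List ℕ → List (ℕ × ℕ)) :
    isFinal (Nat.pair t r) (stepRun (Nat.pair t r) T σ) = true ↔
      ∃ p : T.Pos, localCheck t r (slice T p).code (σ p.1) = true := by
  rw [← (stepRun_atom ht σ).1, isFinal]
  simp [ht, h4, h5]

theorem isFinal_stepRun_equality {t r : ℕ} (ht : t = 4 ∨ t = 5) (σ : List ℕ → List (ℕ × ℕ)) :
    isFinal (Nat.pair t r) (stepRun (Nat.pair t r) T σ) = true ↔
      ¬ ∃ p : T.Pos, localCheck t r (slice T p).code (σ p.1) = true := by
  rw [← (stepRun_atom (by omega) σ).2, isFinal]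
  rcases ht with rfl | rfl <;> simp

theorem stepRun_binary {t a b : ℕ} (ht : t = 10 ∨ t = 11) (σ : List ℕ → List (ℕ × ℕ)) :
    stepRun (Nat.pair t (Nat.pair a b)) T σ = Nat.pair (stepRun a T σ) (stepRun b T σ) := by
  refine Eq.trans (Term.run_congr fun p f _ qs => ?_)
    (Term.run_pair (fun p (f : Sig) qs => step a f.1.code (σ p) qs)
      (fun p (f : Sig) qs => step b f.1.code (σ p) qs) T)
  rw [step]
  simp only [Nat.unpair_pair]
  rw [dif_neg (by omega), if_pos (by omega)]

/-- The automata are deterministic, so negation changes the final states and leaves the run as it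
is. -/
theorem stepRun_not {a : ℕ} (σ : List ℕ → List (ℕ × ℕ)) :
    stepRun (Nat.pair 12 a) T σ = stepRun a T σ := by
  refine Term.run_congr fun p f _ qs => ?_
  rw [step]
  simp

end SliceTerm

/-! ### Truth of formulas -/

namespace SliceTerm

section Truth

variable {Γ₁ : Type u} {Γ₂ : Type v}
variable {Sig : Set (UnitSlice Γ₁ Γ₂)} {T : SliceTerm Sig}

theorem exists_support {P : T.Pos → Prop} :
    (∃ p : T.Pos, (slice T p).center.isSome ∧ P p) ↔ ∃ v : Support T, P v.1 :=
  ⟨fun ⟨p, h, hP⟩ => ⟨⟨p, h⟩, hP⟩, fun ⟨v, hP⟩ => ⟨v.1, v.2, hP⟩⟩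

theorem exists_edgePart {P : EdgePart T → Prop} :
    (∃ (p : T.Pos) (e : Fin (slice T p).numEdges), P ⟨p, e⟩) ↔ ∃ x, P x :=
  ⟨fun ⟨p, e, hP⟩ => ⟨⟨p, e⟩, hP⟩, fun ⟨x, hP⟩ => ⟨x.pos, x.edge, hP⟩⟩

/-- The masks `σ` at the positions of `T` represent the interpretation `M`. -/
structure Represents (M : Interpretation (toDigraph T)) (σ : List ℕ → List (ℕ × ℕ)) : Prop where
  vertex : ∀ (x : ℕ) (v : Support T),
    (envGet (σ v.1.1) 13 x).testBit 0 = true ↔ M.vertex x = some v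
  edge : ∀ y : ℕ, markedParts T (fun p => envGet (σ p) 14 y) = partsOf {K | M.edge y = some K}
  vertexSet : ∀ (X : ℕ) (v : Support T),
    (envGet (σ v.1.1) 15 X).testBit 0 = true ↔ v ∈ M.vertexSet X
  edgeSet : ∀ Y : ℕ, markedParts T (fun p => envGet (σ p) 16 Y) = partsOf (M.edgeSet Y)

namespace Represents

variable {M : Interpretation (toDigraph T)} {σ : List ℕ → List (ℕ × ℕ)}

theorem mem_edge (h : Represents M σ) (y : ℕ) (x : EdgePart T) :
    (envGet (σ x.pos.1) 14 y).testBit x.edge = true ↔ ∃ K, M.edge y = some K ∧ x ∈ K.parts :=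
  Set.ext_iff.1 (h.edge y) x

theorem mem_edgeSet (h : Represents M σ) (Y : ℕ) (x : EdgePart T) :
    (envGet (σ x.pos.1) 16 Y).testBit x.edge = true ↔ ∃ K ∈ M.edgeSet Y, x ∈ K.parts :=
  Set.ext_iff.1 (h.edgeSet Y) x

theorem update_vertex (h : Represents M σ) {x : ℕ} {v : Support T} {m : List ℕ → ℕ}
    (hm : ∀ w : Support T, (m w.1.1).testBit 0 = true ↔ v = w) :
    Represents { M with vertex := Function.update M.vertex x (some v) }
      fun p => (Nat.pair 13 x, m p) :: σ p where
  vertex x' w := by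
    rw [envGet_cons]
    by_cases hx : x' = x
    · subst hx
      simp only [true_and, if_true, hm, Function.update_self]
      exact (Option.some_inj (a := v) (b := w)).symm
    · simp only [hx, and_false, if_false, h.vertex, Function.update_of_ne hx]
  edge y := by simpa [envGet_cons] using h.edge y
  vertexSet X w := by simpa [envGet_cons] using h.vertexSet X w
  edgeSet Y := by simpa [envGet_cons] using h.edgeSet Y

theorem update_edge (h : Represents M σ) {y : ℕ} {K : SlicedEdgeSequence T} {m : List ℕ → ℕ}
    (hm : markedParts T m = partsOf {K}) :
    Represents { M with edge := Function.update M.edge y (some K) }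
      fun p => (Nat.pair 14 y, m p) :: σ p where
  vertex x' w := by simpa [envGet_cons] using h.vertex x' w
  edge y' := by
    simp only [envGet_cons]
    by_cases hy : y' = y
    · subst hy
      simp only [and_self, if_true, Function.update_self]
      refine Eq.trans hm (congrArg partsOf ?_)
      ext K'
      exact eq_comm.trans (Option.some_inj (a := K) (b := K')).symm
    · simp only [hy, and_false, if_false, Function.update_of_ne hy, h.edge]
  vertexSet X w := by simpa [envGet_cons] using h.vertexSet X w
  edgeSet Y := by simpa [envGet_cons] using h.edgeSet Y

theorem update_vertexSet (h : Represents M σ) {X : ℕ} {W : Set (Support T)} {m : List ℕ → ℕ}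
    (hm : ∀ w : Support T, (m w.1.1).testBit 0 = true ↔ w ∈ W) :
    Represents { M with vertexSet := Function.update M.vertexSet X W }
      fun p => (Nat.pair 15 X, m p) :: σ p where
  vertex x' w := by simpa [envGet_cons] using h.vertex x' w
  edge y := by simpa [envGet_cons] using h.edge y
  vertexSet X' w := by
    rw [envGet_cons]
    by_cases hx : X' = X
    · subst hx
      simp only [true_and, if_true, hm]
      exact Iff.of_eq (congrArg (fun A : Set (Support T) => w ∈ A)
        (Function.update_self X' W M.vertexSet).symm)
    · simp only [hx, and_false, if_false, h.vertexSet]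
      exact Iff.of_eq (congrArg (fun A : Set (Support T) => w ∈ A)
        (Function.update_of_ne hx W M.vertexSet).symm)
  edgeSet Y := by simpa [envGet_cons] using h.edgeSet Y

theorem update_edgeSet (h : Represents M σ) {Y : ℕ} {W : Set (SlicedEdgeSequence T)}
    {m : List ℕ → ℕ} (hm : markedParts T m = partsOf W) :
    Represents { M with edgeSet := Function.update M.edgeSet Y W }
      fun p => (Nat.pair 16 Y, m p) :: σ p where
  vertex x' w := by simpa [envGet_cons] using h.vertex x' w
  edge y := by simpa [envGet_cons] using h.edge y
  vertexSet X w := by simpa [envGet_cons] using h.vertexSet X w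
  edgeSet Y' := by
    simp only [envGet_cons]
    by_cases hy : Y' = Y
    · subst hy
      simp only [and_self, if_true, hm]
      exact congrArg partsOf (Function.update_self Y' W M.edgeSet).symm
    · simp only [hy, and_false, if_false, h.edgeSet]
      exact congrArg partsOf (Function.update_of_ne hy W M.edgeSet).symm

end Represents

variable [Encodable Γ₁] [Encodable Γ₂]

theorem guardFinal_edge (hT : IsUnitDecomposition T) (m : List ℕ → ℕ) :
    guardFinal 14 (guardRun 14 T m) = true ↔
      (∃! x : EdgePart T, x ∈ markedParts T m ∧ x.source = .center) ∧
        IsClosedSet (markedParts T m) := by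
  rw [← agree_iff_isClosedSet hT.1, ← guardRun_snd 14, ← guardRun_edge]
  simp [guardFinal]

theorem guardFinal_vertex (m : List ℕ → ℕ) : guardFinal 13 (guardRun 13 T m) = true ↔
    ∃! v : Support T, (m v.1.1).testBit 0 = true := by
  rw [← guardRun_vertex]
  simp [guardFinal]

theorem guardFinal_edgeSet (hT : IsUnitDecomposition T) (m : List ℕ → ℕ) :
    guardFinal 16 (guardRun 16 T m) = true ↔ IsClosedSet (markedParts T m) := by
  rw [← agree_iff_isClosedSet hT.1, ← guardRun_snd 16]
  simp [guardFinal]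

/-- Induction on the formula, with `M` and `σ` arbitrary because quantifiers extend both. Atoms
about edges can be tested in a single slice: sequences sharing a part are equal, and the ends of an
edge and its label are visible at the parts meeting a center. -/
theorem isFinal_iff_holds (hT : IsUnitDecomposition T) (φ : MSO2 Γ₁ Γ₂)
    {M : Interpretation (toDigraph T)} {σ : List ℕ → List (ℕ × ℕ)} (h : Represents M σ) :
    isFinal φ.code (stepRun φ.code T σ) = true ↔ φ.Holds (toDigraph T) M := by
  induction φ generalizing M σ with
  | memV x X =>
    rw [MSO2.code, isFinal_stepRun_atom (by decide) (by decide) (by decide)]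
    simp only [UnitSlice.localCheck_zero]
    rw [exists_support (P := fun p => (envGet (σ p.1) 13 x).testBit 0 = true ∧
      (envGet (σ p.1) 15 X).testBit 0 = true)]
    simp only [h.vertex, h.vertexSet, MSO2.Holds]
    rfl
  | memE y Y =>
    rw [MSO2.code, isFinal_stepRun_atom (by decide) (by decide) (by decide)]
    simp only [UnitSlice.localCheck_one]
    rw [exists_edgePart (P := fun x => (envGet (σ x.pos.1) 14 y).testBit x.edge = true ∧
      (envGet (σ x.pos.1) 16 Y).testBit x.edge = true)]
    simp only [h.mem_edge, h.mem_edgeSet, MSO2.Holds]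
    constructor
    · rintro ⟨x, ⟨K, hK, hx⟩, K', hK', hx'⟩
      -- One common part forces the two sequences to coincide. In the other direction the first part
      -- of the sequence serves as witness.
      obtain rfl := eq_of_mem_parts hx hx'
      exact ⟨K, hK, hK'⟩
    · rintro ⟨K, hK, hK'⟩
      exact ⟨K.parts.head K.ne_nil, ⟨K, hK, List.head_mem _⟩, K, hK', List.head_mem _⟩
  | eqV x x' =>
    rw [MSO2.code, isFinal_stepRun_atom (by decide) (by decide) (by decide)]
    simp only [UnitSlice.localCheck_two]
    rw [exists_support (P := fun p => (envGet (σ p.1) 13 x).testBit 0 = true ∧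
      (envGet (σ p.1) 13 x').testBit 0 = true)]
    simp only [h.vertex, MSO2.Holds]
    rfl
  | eqE y y' =>
    rw [MSO2.code, isFinal_stepRun_atom (by decide) (by decide) (by decide)]
    simp only [UnitSlice.localCheck_three]
    rw [exists_edgePart (P := fun x => (envGet (σ x.pos.1) 14 y).testBit x.edge = true ∧
      (envGet (σ x.pos.1) 14 y').testBit x.edge = true)]
    simp only [h.mem_edge, MSO2.Holds]
    constructor
    · rintro ⟨x, ⟨K, hK, hx⟩, K', hK', hx'⟩
      obtain rfl := eq_of_mem_parts hx hx'
      exact ⟨K, hK, hK'⟩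
    · rintro ⟨K, hK, hK'⟩
      exact ⟨K.parts.head K.ne_nil, ⟨K, hK, List.head_mem _⟩, K, hK', List.head_mem _⟩
  | eqVSet X X' =>
    rw [MSO2.code, isFinal_stepRun_equality (by decide)]
    simp only [UnitSlice.localCheck_four]
    rw [exists_support (P := fun p => ¬ ((envGet (σ p.1) 15 X).testBit 0 = true ↔
      (envGet (σ p.1) 15 X').testBit 0 = true))]
    simp only [h.vertexSet, MSO2.Holds]
    push Not
    exact Set.ext_iff.symm
  | eqESet Y Y' =>
    rw [MSO2.code, isFinal_stepRun_equality (by decide)]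
    simp only [UnitSlice.localCheck_five]
    rw [exists_edgePart (P := fun x => ¬ ((envGet (σ x.pos.1) 16 Y).testBit x.edge = true ↔
      (envGet (σ x.pos.1) 16 Y').testBit x.edge = true))]
    simp only [h.mem_edgeSet, MSO2.Holds]
    push Not
    constructor
    · intro H
      ext K
      -- Membership of `K` in either set can be read off at any of its parts, here at the first one.
      have hK := H (K.parts.head K.ne_nil)
      constructor
      · intro hY
        obtain ⟨K', h1, h2⟩ := hK.1 ⟨K, hY, List.head_mem _⟩
        exact eq_of_mem_parts h2 (List.head_mem K.ne_nil) ▸ h1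
      · intro hY
        obtain ⟨K', h1, h2⟩ := hK.2 ⟨K, hY, List.head_mem _⟩
        exact eq_of_mem_parts h2 (List.head_mem K.ne_nil) ▸ h1
    · intro H x
      rw [H]
  | isSource y x =>
    rw [MSO2.code, isFinal_stepRun_atom (by decide) (by decide) (by decide)]
    simp only [UnitSlice.localCheck_six]
    rw [exists_support (P := fun p => (envGet (σ p.1) 13 x).testBit 0 = true ∧
      ∃ e : Fin (slice T p).numEdges, (envGet (σ p.1) 14 y).testBit e = true ∧
        (slice T p).source e = .center)]
    simp only [h.vertex, MSO2.Holds]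
    constructor
    · rintro ⟨v, hv, e, he, hs⟩
      obtain ⟨K, hK, hx⟩ := (h.mem_edge y ⟨v.1, e⟩).1 he
      refine ⟨K, hK, hv.trans (congrArg some (Subtype.ext ?_))⟩
      -- A part of `K` starting in a center is its first part, so its position is the source of `K`.
      exact congrArg EdgePart.pos (eq_head hx hs)
    · rintro ⟨K, hK, hv⟩
      exact ⟨_, hv, (K.parts.head K.ne_nil).edge,
        (h.mem_edge y (K.parts.head K.ne_nil)).2 ⟨K, hK, List.head_mem _⟩, K.source_eq⟩
  | isTarget y x =>
    rw [MSO2.code, isFinal_stepRun_atom (by decide) (by decide) (by decide)]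
    simp only [UnitSlice.localCheck_seven]
    rw [exists_support (P := fun p => (envGet (σ p.1) 13 x).testBit 0 = true ∧
      ∃ e : Fin (slice T p).numEdges, (envGet (σ p.1) 14 y).testBit e = true ∧
        (slice T p).target e = .center)]
    simp only [h.vertex, MSO2.Holds]
    constructor
    · rintro ⟨v, hv, e, he, hs⟩
      obtain ⟨K, hK, hx⟩ := (h.mem_edge y ⟨v.1, e⟩).1 he
      refine ⟨K, hK, hv.trans (congrArg some (Subtype.ext ?_))⟩
      exact congrArg EdgePart.pos (eq_getLast hx hs)
    · rintro ⟨K, hK, hv⟩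
      exact ⟨_, hv, (K.parts.getLast K.ne_nil).edge,
        (h.mem_edge y (K.parts.getLast K.ne_nil)).2 ⟨K, hK, List.getLast_mem _⟩, K.target_eq⟩
  | hasVertexLabel x a =>
    rw [MSO2.code, isFinal_stepRun_atom (by decide) (by decide) (by decide)]
    simp only [UnitSlice.localCheck_eight, MSO2.Holds]
    constructor
    · rintro ⟨p, hp, hb⟩
      have hs : (slice T p).center.isSome := by rw [hp]; rfl
      refine ⟨⟨p, hs⟩, (h.vertex x ⟨p, hs⟩).1 hb, ?_⟩
      exact Option.get_of_eq_some hs hp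
    · rintro ⟨v, hv, hl⟩
      refine ⟨v.1, ?_, (h.vertex x v).2 hv⟩
      rw [← hl]
      exact (Option.some_get v.2).symm
  | hasEdgeLabel y b =>
    rw [MSO2.code, isFinal_stepRun_atom (by decide) (by decide) (by decide)]
    simp only [UnitSlice.localCheck_nine, MSO2.Holds]
    constructor
    · rintro ⟨p, e, he, hs, hl⟩
      obtain ⟨K, hK, hx⟩ := (h.mem_edge y ⟨p, e⟩).1 he
      refine ⟨K, hK, ?_⟩
      rw [← hl]
      exact congrArg EdgePart.label (eq_head hx hs).symm
    · rintro ⟨K, hK, hl⟩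
      exact ⟨_, (K.parts.head K.ne_nil).edge,
        (h.mem_edge y (K.parts.head K.ne_nil)).2 ⟨K, hK, List.head_mem _⟩, K.source_eq, hl⟩
  | or φ ψ ihφ ihψ =>
    rw [MSO2.code, stepRun_binary (by decide), isFinal, MSO2.Holds, ← ihφ h, ← ihψ h]
    simp
  | and φ ψ ihφ ihψ =>
    rw [MSO2.code, stepRun_binary (by decide), isFinal, MSO2.Holds, ← ihφ h, ← ihψ h]
    simp
  | not φ ih =>
    rw [MSO2.code, stepRun_not, isFinal, MSO2.Holds, ← ih h]
    simp
  | exV x φ ih =>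
    rw [MSO2.code, isFinal_stepRun_quantifier (by decide), MSO2.Holds]
    simp only [guardFinal_vertex]
    constructor
    · rintro ⟨m, -, ⟨v, hv, huniq⟩, hφ⟩
      exact ⟨v, (ih (h.update_vertex fun w =>
        ⟨fun hw => (huniq w hw).symm, fun hw => hw ▸ hv⟩)).1 hφ⟩
    · rintro ⟨v, hφ⟩
      have hm : ∀ w : Support T,
          (if w.1.1 = v.1.1 then 1 else 0 : ℕ).testBit 0 = true ↔ v = w := by
        intro w
        by_cases hw : w.1.1 = v.1.1
        · exact iff_of_true (by simp [hw]) (Subtype.ext (Subtype.ext hw.symm))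
        · simp only [hw, if_false, Nat.zero_testBit, Bool.false_eq_true, false_iff]
          rintro rfl
          exact hw rfl
      refine ⟨fun p => if p = v.1.1 then 1 else 0, fun p => ?_, ⟨v, (hm v).2 rfl, fun w hw =>
        ((hm w).1 hw).symm⟩, (ih (h.update_vertex hm)).2 hφ⟩
      -- The guessed masks have one bit more than there are edges, so that bit 0 can mark the center
      -- of a slice without edges.
      have : 1 < 2 ^ ((slice T p).numEdges + 1) := Nat.one_lt_two_pow (by omega)
      dsimp only
      split_ifs <;> omega
  | exE y φ ih =>
    rw [MSO2.code, isFinal_stepRun_quantifier (by decide), MSO2.Holds]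
    simp only [guardFinal_edge hT]
    constructor
    · rintro ⟨m, -, ⟨hu, hc⟩, hφ⟩
      obtain ⟨K, hK⟩ := hc.exists_eq_singleton hT hu
      exact ⟨K, (ih (h.update_edge hK)).1 hφ⟩
    · rintro ⟨K, hφ⟩
      obtain ⟨m, hm, hK⟩ := exists_markedParts (partsOf {K})
      refine ⟨m, fun p => (hm p).trans (Nat.pow_lt_pow_right (by omega) (by omega)), ?_,
        (ih (h.update_edge hK)).2 hφ⟩
      rw [hK]
      exact ⟨existsUnique_start K, isClosedSet_partsOf _⟩
  | exVSet X φ ih =>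
    rw [MSO2.code, isFinal_stepRun_quantifier (by decide), MSO2.Holds]
    constructor
    · rintro ⟨m, -, -, hφ⟩
      exact ⟨{v | (m v.1.1).testBit 0 = true}, (ih (h.update_vertexSet fun w => Iff.rfl)).1 hφ⟩
    · rintro ⟨W, hφ⟩
      classical
      have hm : ∀ w : Support T,
          (if ∃ v : Support T, v ∈ W ∧ v.1.1 = w.1.1 then 1 else 0 : ℕ).testBit 0 = true ↔
            w ∈ W := by
        intro w
        by_cases hw : ∃ v : Support T, v ∈ W ∧ v.1.1 = w.1.1
        · obtain ⟨v, hv, e⟩ := id hw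
          obtain rfl : v = w := Subtype.ext (Subtype.ext e)
          rw [if_pos hw]
          simpa using hv
        · simp only [hw, if_false, Nat.zero_testBit, Bool.false_eq_true, false_iff]
          exact fun h => hw ⟨w, h, rfl⟩
      refine ⟨fun p => if ∃ v : Support T, v ∈ W ∧ v.1.1 = p then 1 else 0, fun p => ?_, rfl,
        (ih (h.update_vertexSet hm)).2 hφ⟩
      have : 1 < 2 ^ ((slice T p).numEdges + 1) := Nat.one_lt_two_pow (by omega)
      dsimp only
      split_ifs <;> omega
  | exESet Y φ ih =>
    rw [MSO2.code, isFinal_stepRun_quantifier (by decide), MSO2.Holds]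
    simp only [guardFinal_edgeSet hT]
    constructor
    · rintro ⟨m, -, hc, hφ⟩
      exact ⟨_, (ih (h.update_edgeSet (hc.eq_partsOf hT))).1 hφ⟩
    · rintro ⟨W, hφ⟩
      obtain ⟨m, hm, hK⟩ := exists_markedParts (partsOf W)
      refine ⟨m, fun p => (hm p).trans (Nat.pow_lt_pow_right (by omega) (by omega)), ?_,
        (ih (h.update_edgeSet hK)).2 hφ⟩
      rw [hK]
      exact isClosedSet_partsOf _

theorem isFinal_iff_models (hT : IsUnitDecomposition T) (φ : MSO2 Γ₁ Γ₂) :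
    isFinal φ.code (stepRun φ.code T fun _ => []) = true ↔ (toDigraph T).Models φ := by
  refine isFinal_iff_holds hT φ ⟨fun x v => ?_, fun y => ?_, fun X v => ?_, fun Y => ?_⟩
  · simp [envGet]
  · ext x; simp [envGet, markedParts, partsOf]
  · exact iff_of_false (by simp [envGet]) fun h => h
  · ext x
    refine iff_of_false (by simp [envGet, markedParts]) ?_
    rintro ⟨K, hK, -⟩
    exact hK

end Truth

end SliceTerm

/-! ### The automata and their effectiveness -/

section Bounds

variable {Γ₁ : Type u} {Γ₂ : Type v} [Encodable Γ₁] [Encodable Γ₂]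
variable {S : UnitSlice Γ₁ Γ₂} {B c : ℕ}

/-- The bound holds for arbitrary states of the children, since a successful comparison yields the
interface of the slice alone. -/
theorem tileStep_lt (hB : ∀ b : Γ₂, Encodable.encode b < B) (hS : S.extraWidth ≤ c) (m : ℕ)
    (qs : List ℕ) : tileStep S.code m qs < tileBound B c := by
  have := UnitSlice.tile_code_lt hB hS m 0
  unfold tileStep
  rcases Bool.eq_false_or_eq_true (qs == (List.range qs.length).map fun j =>
    tile S.code m (j + 1) + 1) with h | h <;> rw [h]
  · exact this
  · simp only [cond_false]; omega

theorem guardStep_lt (hB : ∀ b : Γ₂, Encodable.encode b < B) (hS : S.extraWidth ≤ c) (t m : ℕ)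
    (qs : List ℕ) : guardStep t S.code m qs < guardBound B c :=
  pair_lt_add_sq (by omega) (tileStep_lt hB hS m _)

/-- The states of `step k` below `stateBound B c k` are closed under transitions. -/
theorem step_lt (hB : ∀ b : Γ₂, Encodable.encode b < B) (hS : S.extraWidth ≤ c) (k : ℕ)
    (σ : List (ℕ × ℕ)) (qs : List ℕ) : step k S.code σ qs < stateBound B c k := by
  induction k using Nat.strong_induction_on generalizing σ qs with
  | _ k ih =>
    rw [step, stateBound]
    split_ifs with h1 h2 h3
    · rcases Bool.eq_false_or_eq_true (localCheck k.unpair.1 k.unpair.2 S.code σ ||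
        qs.any fun q => q == 1) with h | h <;> rw [h] <;> simp
    · exact pair_lt_add_sq (ih _ (unpair_snd_fst_lt (by omega)) _ _)
        (ih _ (unpair_snd_snd_lt (by omega)) _ _)
    · exact ih _ (unpair_snd_lt (by omega)) _ _
    · apply maskOf_lt
      intro i hi
      obtain ⟨y, -, rfl⟩ := List.mem_map.1 hi
      exact pair_lt_add_sq (guardStep_lt hB hS _ _ _) (ih _ (unpair_snd_snd_lt (by omega)) _ _)

end Bounds

section Automaton

variable {Γ₁ : Type u} {Γ₂ : Type v}

/-- The automaton `A(φ, c)`; the codes of edge labels are less than `B`. -/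
def mso2Automaton [Encodable Γ₁] [Encodable Γ₂] (B : ℕ) (φ : MSO2 Γ₁ Γ₂) (c : ℕ) :
    SliceAutomaton (normalizedAlphabet c Γ₁ Γ₂) where
  numStates := jointBound B c φ.code
  final := {q | jointFinal φ.code q = true}
  trans S qs q := (q : ℕ) = jointStep φ.code S.1.code (List.ofFn fun i => (qs i : ℕ))

/-- The joint run is the product of the gluing test and the run of the formula automaton. The latter
is meaningful only on unit decompositions, and the first component ensures that only these are
accepted. -/
theorem language_mso2Automaton [Encodable Γ₁] [Encodable Γ₂] {B : ℕ}
    (hB : ∀ b : Γ₂, Encodable.encode b < B) (φ : MSO2 Γ₁ Γ₂) (c : ℕ) :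
    (mso2Automaton B φ c).language = {T | T ∈ unitDecompositions (normalizedAlphabet c Γ₁ Γ₂) ∧
      (SliceTerm.toDigraph T).Models φ} := by
  classical
  ext T
  have hlt : ∀ (f : normalizedAlphabet c Γ₁ Γ₂) (qs : List ℕ),
      jointStep φ.code f.1.code qs < jointBound B c φ.code := fun f qs =>
    pair_lt_add_sq (tileStep_lt hB f.2.1.2.2 _ _) (step_lt hB f.2.1.2.2 _ _ _)
  have hreach := TreeAutomaton.reaches_iff_run (A := mso2Automaton B φ c)
    (δ := fun f qs => jointStep φ.code f.1.code qs) (fun f qs q => Iff.rfl)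
    (fun f qs _ => hlt f qs) T
  set r := Term.run (fun _ (f : normalizedAlphabet c Γ₁ Γ₂) qs =>
    jointStep φ.code f.1.code qs) T with hr
  have hrlt : r < jointBound B c φ.code := Term.run_lt fun _ f _ qs _ => hlt f qs
  have h1 : T ∈ (mso2Automaton B φ c).language ↔ jointFinal φ.code r = true := by
    constructor
    · rintro ⟨q, hq, hTq⟩
      rw [← (hreach q).1 hTq]
      exact hq
    · intro h
      exact ⟨⟨r, hrlt⟩, h, (hreach _).2 rfl⟩
  have hpair : r = Nat.pair _ _ := Term.run_pair
    (fun _ (f : normalizedAlphabet c Γ₁ Γ₂) qs => tileStep f.1.code (fullMask f.1.code) qs)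
    (fun _ (f : normalizedAlphabet c Γ₁ Γ₂) qs => step φ.code f.1.code [] qs) T
  have htile := Term.run_agree
    (fun _ (f : normalizedAlphabet c Γ₁ Γ₂) => tile f.1.code (fullMask f.1.code) 0)
    (fun _ (f : normalizedAlphabet c Γ₁ Γ₂) j => tile f.1.code (fullMask f.1.code) j) T
  -- The value is 0 if some gluing fails and otherwise the interface of the root plus one, so 1
  -- means that all gluings succeed and the root has an empty out-frontier.
  have htile' : Term.run (fun _ (f : normalizedAlphabet c Γ₁ Γ₂) qs =>
      tileStep f.1.code (fullMask f.1.code) qs) T = 1 ↔ SliceTerm.IsUnitDecomposition T := by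
    unfold tileStep SliceTerm.IsUnitDecomposition
    rw [htile, ← SliceTerm.agree_fullMask_iff, ← UnitSlice.tile_code_eq_zero]
    split_ifs with h <;> simp [h]
  rw [h1, hpair, jointFinal, Nat.unpair_pair, Bool.and_eq_true, beq_iff_eq, htile']
  exact and_congr_right fun hT => SliceTerm.isFinal_iff_models hT φ

end Automaton

end SliceTree

theorem mainTheorem8 {Γ₁ : Type*} {Γ₂ : Type*} [Finite Γ₁] [Finite Γ₂]
    [Primcodable Γ₁] [Primcodable Γ₂] :
    ∃ A : Sentence Γ₁ Γ₂ → (c : ℕ) → SliceAutomaton (normalizedAlphabet c Γ₁ Γ₂),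
      IsEffectiveFamily A ∧
      ∀ (φ : Sentence Γ₁ Γ₂) (c : ℕ),
        (A φ c).IsDeterministic ∧
        IsSliceTreeAutomaton (A φ c) ∧
        IsNormalizedAutomaton (A φ c) ∧
        (A φ c).language =
          {T | T ∈ unitDecompositions (normalizedAlphabet c Γ₁ Γ₂) ∧
            (SliceTerm.toDigraph T).Models φ.1} := by
  -- As `Γ₂` is finite, the codes of its elements are bounded. The bound is a fixed constant, so
  -- choosing it does not affect computability in the formula and `c`.
  obtain ⟨B, hB⟩ : ∃ B, ∀ b : Γ₂, Encodable.encode b < B := by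
    obtain ⟨B, hB⟩ := (Set.finite_range (Encodable.encode : Γ₂ → ℕ)).bddAbove
    exact ⟨B + 1, fun b => Nat.lt_succ_of_le (hB ⟨b, rfl⟩)⟩
  refine ⟨fun φ c => mso2Automaton B φ.1 c, ?_, fun φ c => ⟨?_, ?_, ?_, ?_⟩⟩
  · refine ⟨fun x => jointBound B x.2 x.1, fun x => jointFinal x.1.1 x.2,
      fun x => x.2.2.2 == jointStep x.1.1 x.2.1 x.2.2.1, (primrec_jointBound B).to_comp,
      primrec_jointFinal.to_comp, primrec_jointStep.to_comp, fun φ c => ⟨rfl, fun q => Iff.rfl,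
      fun S qs q => beq_iff_eq.symm⟩⟩
  · intro S qs q q' h h'
    exact Fin.ext (Eq.trans h (Eq.symm h'))
  · intro T hT
    rw [language_mso2Automaton hB] at hT
    exact hT.1
  -- All slices of the alphabet are normalized, hence so is every term over it.
  · exact fun T _ p => (T.symbolAt p).2.2
  · exact language_mso2Automaton hB φ.1 c
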